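/- Conventions. Let $\mathcal{O}$ be a commutative ring; algebras are associative unital $\mathcal{O}$-algebras, $\otimes=\otimes_{\mathcal O}$, and on every bimodule the two induced $\mathcal{O}$-actions coincide. Let $\bar G$ be a finite group and $n\ge 1$. A $\bar G$-graded algebra $\mathcal C=\bigoplus_{g}\mathcal C_g$ is *$\bar G$-acted* if $\bar G$ acts on it on the left by algebra automorphisms $c\mapsto {}^g c$ with ${}^g\mathcal C_h\subseteq \mathcal C_{ghg^{-1}}$. A *$\bar G$-graded crossed product over $\mathcal C$* is a $\bar G$-graded algebra $A=\bigoplus_g A_g$ having a unit in each $A_g$, together with an algebra homomorphism $\zeta:\mathcal C\to C_A(A_1)$ with $\zeta(\mathcal C_g)\subseteq A_g$ and $\zeta({}^gc)=u\,\zeta(c)\,u^{-1}$ for every unit $u\in A_g$, $g\in\bar G$, $c\in\mathcal C$. For two such $A,A'$ (with structure maps $\zeta,\zeta'$), a *$\bar G$-graded $(A,A')$-bimodule over $\mathcal C$* is an $(A,A')$-bimodule $\tilde M=\bigoplus_g\tilde M_g$ with $A_g\tilde M_xA'_h\subseteq\tilde M_{gxh}$ and $m\,\zeta'(c)=\zeta({}^gc)\,m$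 for $m\in\tilde M_g$, $c\in\mathcal C$; isomorphisms of these are grade-preserving bimodule isomorphisms. The dual $\tilde M^*=\mathrm{Hom}_A(\tilde M,A)$ is an $(A',A)$-bimodule by $(a'\varphi)(m)=\varphi(ma')$, $(\varphi a)(m)=\varphi(m)a$, graded by $\tilde M^*_g=\{\varphi:\varphi(\tilde M_x)\subseteq A_{xg}\ \forall x\}$. One says that $\tilde M$ *induces a $\bar G$-graded Morita equivalence over $\mathcal C$* between $A$ and $A'$ if $\tilde M\otimes_{A'}\tilde M^*\simeq A$ and $\tilde M^*\otimes_A\tilde M\simeq A'$ as graded bimodules (the $g$-component of a tensor product being the sum of the images of the products of an $x$- and a $y$-component with $xy=g$). Wreath products. $\bar G\wr S_n=\bar G^n\rtimes S_n$ with $({}^\sigma g)_i=g_{\sigma^{-1}(i)}$. For $X=A$, $A'$ or $\tilde M$ put $X\wr S_n=X^{\otimes n}\otimes\mathcal O S_n$, with multiplication, left and right actions all given by $((x_1\otimes\dots\otimes x_n)\otimes\sigma)((y_1\otimes\dots\otimes y_n)\otimes\tau)=(x_1y_{\sigma^{-1}(1)}\otimes\dots\otimes x_ny_{\sigma^{-1}(n)})\otimes\sigma\tau$,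 and with $((g_1,\dots,g_n),\sigma)$-component $(X_{g_1}\otimes\dots\otimes X_{g_n})\otimes\mathcal O\sigma$. The algebra $\mathcal C^{\otimes n}$ carries the action ${}^{((g_i),\sigma)}(c_1\otimes\dots\otimes c_n)={}^{g_1}c_{\sigma^{-1}(1)}\otimes\dots\otimes{}^{g_n}c_{\sigma^{-1}(n)}$ of $\bar G\wr S_n$ and its natural $\bar G^n$-grading, regarded as a $\bar G\wr S_n$-grading that is zero outside $\bar G^n$; the structure map to $A\wr S_n$ is $c_1\otimes\dots\otimes c_n\mapsto(\zeta(c_1)\otimes\dots\otimes\zeta(c_n))\otimes 1$, and similarly for $A'$. Theorem. Let $\mathcal C$ be a $\bar G$-graded $\bar G$-acted algebra, let $A$, $A'$ be $\bar G$-graded crossed products over $\mathcal C$ with identity components $B=A_1$, $B'=A'_1$, and let $\tilde M$ be a $\bar G$-graded $(A,A')$-bimodule over $\mathcal C$ with identity component $M=\tilde M_1$. Then: (1) $\mathcal C^{\otimes n}$ is a $\bar G\wr S_n$-graded $\bar G\wr S_n$-acted algebra, $A\wr S_n$ and $A'\wr S_n$ are $\bar G\wr S_n$-graded crossed products over $\mathcal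 C^{\otimes n}$, and $\tilde M\wr S_n$ is a $\bar G\wr S_n$-graded $(A\wr S_n,A'\wr S_n)$-bimodule over $\mathcal C^{\otimes n}$. If $\tilde M$ is finitely generated over $A$ (respectively over $A'$), then so is $\tilde M\wr S_n$ over $A\wr S_n$ (respectively over $A'\wr S_n$). (2) There is a unique right $A'\wr S_n$-module structure on $(A\wr S_n)\otimes_{B^{\otimes n}}M^{\otimes n}$ such that $(\alpha\otimes m)a'=\alpha u\otimes u^{-1}ma'$ whenever $u\in A\wr S_n$ is a unit and $u$, $a'\in A'\wr S_n$ are homogeneous of the same degree, and a unique left $A\wr S_n$-module structure on $M^{\otimes n}\otimes_{B'^{\otimes n}}(A'\wr S_n)$ such that $a(m\otimes\alpha')=amu'^{-1}\otimes u'\alpha'$ whenever $u'\in A'\wr S_n$ is a unit and $u'$, $a\in A\wr S_n$ are homogeneous of the same degree; here $u^{-1}ma'$ and $amu'^{-1}$ are computed in $\tilde M\wr S_n$, with $M^{\otimes n}$ identified with its identity component. With these structures, and with the gradings given by those of $A\wr S_n$ and $A'\wr S_n$, $$(A\wr S_n)\otimes_{B^{\otimes n}}M^{\otimes n}\;\simeq\;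 \tilde M\wr S_n\;\simeq\; M^{\otimes n}\otimes_{B'^{\otimes n}}(A'\wr S_n)$$ as $\bar G\wr S_n$-graded $(A\wr S_n,A'\wr S_n)$-bimodules over $\mathcal C^{\otimes n}$. (3) If $\tilde M$ induces a $\bar G$-graded Morita equivalence over $\mathcal C$ between $A$ and $A'$, then $\tilde M\wr S_n$ induces a $\bar G\wr S_n$-graded Morita equivalence over $\mathcal C^{\otimes n}$ between $A\wr S_n$ and $A'\wr S_n$. -/

import Mathlib

open scoped TensorProduct
open MulOpposite

noncomputable section

namespace GradedMorita

/-! ## Group graded algebras and bimodules -/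

section Graded

variable {O : Type*} [CommRing O] {Γ : Type*} [Group Γ]
variable {C : Type*} [Ring C] [Algebra O C]
variable {A : Type*} [Ring A] [Algebra O A] {A' : Type*} [Ring A'] [Algebra O A']
variable {M : Type*} [AddCommGroup M] [Module O M] [Module A M] [Module A'ᵐᵒᵖ M]

open Classical in
/-- `A = ⨁_g 𝒜 g` is a `Γ`-graded `O`-algebra (the group `Γ` is written multiplicatively). -/
structure IsGradedAlgebra (𝒜 : Γ → Submodule O A) : Prop where
  isInternal : DirectSum.IsInternal 𝒜
  one_mem : (1 : A) ∈ 𝒜 1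
  mul_mem : ∀ {g h : Γ} {a b : A}, a ∈ 𝒜 g → b ∈ 𝒜 h → a * b ∈ 𝒜 (g * h)

/-- `C` is a `Γ`-graded `Γ`-acted algebra: `Γ` acts (on the left, by `O`-algebra automorphisms)
through `ρ`, and `ᵍ(𝒞 h) ⊆ 𝒞 (g h g⁻¹)`. -/
structure IsGradedActedAlgebra (𝒞 : Γ → Submodule O C) (ρ : Γ →* (C ≃ₐ[O] C)) : Prop
    extends IsGradedAlgebra 𝒞 where
  act_mem : ∀ {g h : Γ} {c : C}, c ∈ 𝒞 h → ρ g c ∈ 𝒞 (g * h * g⁻¹)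

/-- A crossed product: a graded algebra with an invertible element in each component. -/
structure IsCrossedProduct (𝒜 : Γ → Submodule O A) : Prop extends IsGradedAlgebra 𝒜 where
  exists_unit : ∀ g : Γ, ∃ u : Aˣ, (u : A) ∈ 𝒜 g

/-- `A` is a `Γ`-graded crossed product over `C` with structure map `ζ : C → C_A(A₁)`, a
homomorphism of `Γ`-graded `Γ`-acted algebras. The action of `g` on the centralizer `C_A(A₁)` is
conjugation by any invertible element `u` of `A_g`. -/
structure IsCrossedProductOver (𝒞 : Γ → Submodule O C) (ρ : Γ →* (C ≃ₐ[O] C))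
    (𝒜 : Γ → Submodule O A) (ζ : C →ₐ[O] A) : Prop extends IsCrossedProduct 𝒜 where
  map_mem_centralizer : ∀ c : C, ζ c ∈ Subalgebra.centralizer O (𝒜 1 : Set A)
  map_mem : ∀ {h : Γ} {c : C}, c ∈ 𝒞 h → ζ c ∈ 𝒜 h
  map_act : ∀ (g : Γ) (c : C) (u : Aˣ), (u : A) ∈ 𝒜 g → ζ (ρ g c) = u * ζ c * (u⁻¹ : Aˣ)

open Classical in
/-- `M = ⨁_g ℳ g` is a `Γ`-graded `(A, A')`-bimodule over `C`. Right `A'`-modules are left modules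
over the opposite ring: `op a' • m` is `m a'`. The scalar tower fields say that the two actions
are `O`-bilinear, for the given `O`-module structure of `M`. -/
structure IsGradedBimoduleOver (ρ : Γ →* (C ≃ₐ[O] C))
    (𝒜 : Γ → Submodule O A) (𝒜' : Γ → Submodule O A') (ζ : C →ₐ[O] A) (ζ' : C →ₐ[O] A')
    (ℳ : Γ → Submodule O M) : Prop where
  tower_left : IsScalarTower O A M
  tower_right : IsScalarTower O A'ᵐᵒᵖ M
  smul_comm : SMulCommClass A A'ᵐᵒᵖ M
  isInternal : DirectSum.IsInternal ℳ
  smul_mem : ∀ {g x : Γ} {a : A} {m : M}, a ∈ 𝒜 g → m ∈ ℳ x → a • m ∈ ℳ (g * x)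
  op_smul_mem : ∀ {x h : Γ} {m : M} {a' : A'}, m ∈ ℳ x → a' ∈ 𝒜' h → op a' • m ∈ ℳ (x * h)
  twist : ∀ {g : Γ} {m : M} (c : C), m ∈ ℳ g → op (ζ' c) • m = ζ (ρ g c) • m

/-- The identity component `B = A₁` of a graded algebra. -/
def IsGradedAlgebra.oneAlg {𝒜 : Γ → Submodule O A} (hA : IsGradedAlgebra 𝒜) : Subalgebra O A where
  carrier := 𝒜 1
  one_mem' := hA.one_mem
  mul_mem' ha hb := by simpa using hA.mul_mem ha hb
  zero_mem' := zero_mem _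
  add_mem' := add_mem
  algebraMap_mem' r := by
    rw [Algebra.algebraMap_eq_smul_one]
    exact Submodule.smul_mem _ _ hA.one_mem

/-- The identity component `M₁` of a graded bimodule. -/
def IsGradedBimoduleOver.One {ρ : Γ →* (C ≃ₐ[O] C)} {𝒜 : Γ → Submodule O A}
    {𝒜' : Γ → Submodule O A'} {ζ : C →ₐ[O] A} {ζ' : C →ₐ[O] A'} {ℳ : Γ → Submodule O M}
    (_ : IsGradedBimoduleOver ρ 𝒜 𝒜' ζ ζ' ℳ) : Type _ := ↥(ℳ 1)

section One

variable {ρ : Γ →* (C ≃ₐ[O] C)} {𝒜 : Γ → Submodule O A} {𝒜' : Γ → Submodule O A'}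
  {ζ : C →ₐ[O] A} {ζ' : C →ₐ[O] A'} {ℳ : Γ → Submodule O M}
  (hA : IsGradedAlgebra 𝒜) (hA' : IsGradedAlgebra 𝒜')
  (hM : IsGradedBimoduleOver ρ 𝒜 𝒜' ζ ζ' ℳ)

instance : AddCommGroup hM.One := inferInstanceAs (AddCommGroup ↥(ℳ 1))
instance : Module O hM.One := inferInstanceAs (Module O ↥(ℳ 1))

/-- The inclusion of the identity component `M₁` in `M`. -/
def IsGradedBimoduleOver.incl : hM.One →ₗ[O] M := (ℳ 1).subtype

/-- `M₁` is a left `A₁`-module. -/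
instance : Module ↥hA.oneAlg hM.One where
  smul b m := (⟨(b : A) • hM.incl m, by have h := hM.smul_mem b.2 m.2; rwa [one_mul] at h⟩ : ↥(ℳ 1))
  one_smul m := Subtype.ext (one_smul A (hM.incl m))
  mul_smul b b' m := Subtype.ext (mul_smul (b : A) (b' : A) (hM.incl m))
  smul_zero b := Subtype.ext (smul_zero (b : A))
  smul_add b m m' := Subtype.ext (smul_add (b : A) (hM.incl m) (hM.incl m'))
  add_smul b b' m := Subtype.ext (add_smul (b : A) (b' : A) (hM.incl m))
  zero_smul m := Subtype.ext (zero_smul A (hM.incl m))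

/-- `M₁` is a right `A'₁`-module. -/
instance : Module (↥hA'.oneAlg)ᵐᵒᵖ hM.One where
  smul b m := (⟨op (b.unop : A') • hM.incl m, by
    have h := hM.op_smul_mem m.2 b.unop.2; rwa [one_mul] at h⟩ : ↥(ℳ 1))
  one_smul m := Subtype.ext (one_smul A'ᵐᵒᵖ (hM.incl m))
  mul_smul b b' m :=
    Subtype.ext (mul_smul (op (b.unop : A')) (op (b'.unop : A')) (hM.incl m))
  smul_zero b := Subtype.ext (smul_zero (op (b.unop : A')))
  smul_add b m m' := Subtype.ext (smul_add (op (b.unop : A')) (hM.incl m) (hM.incl m'))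
  add_smul b b' m :=
    Subtype.ext (add_smul (op (b.unop : A')) (op (b'.unop : A')) (hM.incl m))
  zero_smul m := Subtype.ext (zero_smul A'ᵐᵒᵖ (hM.incl m))

instance : IsScalarTower O ↥hA.oneAlg hM.One where
  smul_assoc r b m := Subtype.ext (hM.tower_left.smul_assoc r (b : A) (hM.incl m))

instance : IsScalarTower O (↥hA'.oneAlg)ᵐᵒᵖ hM.One where
  smul_assoc r b m :=
    Subtype.ext (hM.tower_right.smul_assoc r (op (b.unop : A')) (hM.incl m))

end One

/-- Two graded `(A, A')`-bimodules are isomorphic as graded bimodules. -/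
def GradedBimoduleIso (A : Type*) [Ring A] (A' : Type*) [Ring A']
    {M N : Type*} [AddCommGroup M] [Module O M] [Module A M] [Module A'ᵐᵒᵖ M]
    [AddCommGroup N] [Module O N] [Module A N] [Module A'ᵐᵒᵖ N]
    (ℳ : Γ → Submodule O M) (𝒩 : Γ → Submodule O N) : Prop :=
  ∃ e : M ≃ₗ[O] N, (∀ (a : A) (m : M), e (a • m) = a • e m) ∧
    (∀ (a' : A') (m : M), e (op a' • m) = op a' • e m) ∧
    ∀ g : Γ, (ℳ g).map (e : M →ₗ[O] N) = 𝒩 g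

end Graded

/-! ## Tensor products over noncommutative rings -/

section BalancedTensor

variable (O : Type*) [CommRing O] (R : Type*) [Ring R]
variable (X : Type*) [AddCommGroup X] [Module O X] [Module Rᵐᵒᵖ X]
variable (Y : Type*) [AddCommGroup Y] [Module O Y] [Module R Y]

/-- The relations `x r ⊗ y = x ⊗ r y`. -/
def balancedRel : Submodule O (X ⊗[O] Y) :=
  Submodule.span O
    {t | ∃ (x : X) (r : R) (y : Y), t = (op r • x) ⊗ₜ[O] y - x ⊗ₜ[O] (r • y)}

/-- The tensor product `X ⊗_R Y` of a right and a left module over an `O`-algebra `R`. -/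
def BalancedTensor : Type _ := (X ⊗[O] Y) ⧸ balancedRel O R X Y

instance : AddCommGroup (BalancedTensor O R X Y) :=
  inferInstanceAs (AddCommGroup ((X ⊗[O] Y) ⧸ balancedRel O R X Y))

instance BalancedTensor.instModuleBase : Module O (BalancedTensor O R X Y) :=
  inferInstanceAs (Module O ((X ⊗[O] Y) ⧸ balancedRel O R X Y))

variable {X Y}

/-- The pure tensor `x ⊗ y` in `X ⊗_R Y`. -/
def BalancedTensor.tmul (x : X) (y : Y) : BalancedTensor O R X Y :=
  (balancedRel O R X Y).mkQ (x ⊗ₜ[O] y)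

theorem BalancedTensor.hom_ext {P : Type*} [AddCommGroup P] [Module O P]
    {f g : BalancedTensor O R X Y →ₗ[O] P}
    (h : ∀ (x : X) (y : Y), f (tmul O R x y) = g (tmul O R x y)) : f = g :=
  Submodule.linearMap_qext _ (TensorProduct.ext' h)

theorem BalancedTensor.tmul_add (x : X) (y y' : Y) :
    tmul O R x (y + y') = tmul O R x y + tmul O R x y' := by
  simp only [tmul, TensorProduct.tmul_add, map_add]; rfl

theorem BalancedTensor.add_tmul (x x' : X) (y : Y) :
    tmul O R (x + x') y = tmul O R x y + tmul O R x' y := by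
  simp only [tmul, TensorProduct.add_tmul, map_add]; rfl

theorem BalancedTensor.tmul_zero (x : X) : tmul O R x (0 : Y) = 0 := by
  simp only [tmul, TensorProduct.tmul_zero, map_zero]; rfl

theorem BalancedTensor.zero_tmul (y : Y) : tmul O R (0 : X) y = 0 := by
  simp only [tmul, TensorProduct.zero_tmul, map_zero]; rfl

variable (X Y)

section Left

variable (S : Type*) [Ring S] [Algebra O S] [Module S X] [IsScalarTower O S X]
  [SMulCommClass S Rᵐᵒᵖ X]

/-- The endomorphism `x ⊗ y ↦ s x ⊗ y` of `X ⊗_R Y`. -/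
def BalancedTensor.leftAct (s : S) : Module.End O (BalancedTensor O R X Y) :=
  (balancedRel O R X Y).mapQ (balancedRel O R X Y)
    (LinearMap.rTensor Y (Algebra.lsmul O O X s)) (by
      refine Submodule.span_le.mpr ?_
      rintro _ ⟨x, r, y, rfl⟩
      refine Submodule.subset_span ⟨s • x, r, y, ?_⟩
      simp [smul_comm s (op r) x])

/-- The left action of `S` on `X ⊗_R Y` through an `(S, R)`-bimodule structure of `X`. -/
def BalancedTensor.leftHom : S →+* Module.End O (BalancedTensor O R X Y) where
  toFun := leftAct O R X Y S
  map_one' := hom_ext O R fun x y => congrArg (tmul O R · y) (one_smul S x)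
  map_mul' s t := hom_ext O R fun x y => congrArg (tmul O R · y) (mul_smul s t x)
  map_zero' := hom_ext O R fun x y =>
    (congrArg (tmul O R · y) (zero_smul S x)).trans (zero_tmul O R y)
  map_add' s t := hom_ext O R fun x y =>
    (congrArg (tmul O R · y) (add_smul s t x)).trans (add_tmul O R _ _ y)

instance (priority := 900) BalancedTensor.instModuleLeft : Module S (BalancedTensor O R X Y) :=
  Module.compHom _ (leftHom O R X Y S)

end Left

section Right

variable (S : Type*) [Ring S] [Algebra O S] [Module Sᵐᵒᵖ Y] [IsScalarTower O Sᵐᵒᵖ Y]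
  [SMulCommClass R Sᵐᵒᵖ Y]

/-- The endomorphism `x ⊗ y ↦ x ⊗ y s` of `X ⊗_R Y`. -/
def BalancedTensor.rightAct (s : Sᵐᵒᵖ) : Module.End O (BalancedTensor O R X Y) :=
  (balancedRel O R X Y).mapQ (balancedRel O R X Y)
    (LinearMap.lTensor X (Algebra.lsmul O O Y s)) (by
      refine Submodule.span_le.mpr ?_
      rintro _ ⟨x, r, y, rfl⟩
      refine Submodule.subset_span ⟨x, r, s • y, ?_⟩
      simp [smul_comm r s y])

/-- The right action of `S` on `X ⊗_R Y` through an `(R, S)`-bimodule structure of `Y`. -/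
def BalancedTensor.rightHom : Sᵐᵒᵖ →+* Module.End O (BalancedTensor O R X Y) where
  toFun := rightAct O R X Y S
  map_one' := hom_ext O R fun x y => congrArg (tmul O R x) (one_smul Sᵐᵒᵖ y)
  map_mul' s t := hom_ext O R fun x y => congrArg (tmul O R x) (mul_smul s t y)
  map_zero' := hom_ext O R fun x y =>
    (congrArg (tmul O R x) (zero_smul Sᵐᵒᵖ y)).trans (tmul_zero O R x)
  map_add' s t := hom_ext O R fun x y =>
    (congrArg (tmul O R x) (add_smul s t y)).trans (tmul_add O R x _ _)

instance (priority := 900) BalancedTensor.instModuleRight :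
    Module Sᵐᵒᵖ (BalancedTensor O R X Y) :=
  Module.compHom _ (rightHom O R X Y S)

end Right

variable {X Y}

theorem BalancedTensor.smul_tmul {S : Type*} [Ring S] [Algebra O S] [Module S X]
    [IsScalarTower O S X] [SMulCommClass S Rᵐᵒᵖ X] (s : S) (x : X) (y : Y) :
    s • tmul O R x y = tmul O R (s • x) y := rfl

theorem BalancedTensor.op_smul_tmul {S : Type*} [Ring S] [Algebra O S] [Module Sᵐᵒᵖ Y]
    [IsScalarTower O Sᵐᵒᵖ Y] [SMulCommClass R Sᵐᵒᵖ Y] (s : S) (x : X) (y : Y) :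
    op s • tmul O R x y = tmul O R x (op s • y) := rfl

variable {O}

/-- The grading of `X ⊗_R Y` by a group: its `g`-component is the sum of the images of
`X_x ⊗ Y_y` with `x y = g`. -/
def tensorGrading {Γ : Type*} [Group Γ]
    (𝒳 : Γ → Submodule O X) (𝒴 : Γ → Submodule O Y) (g : Γ) :
    Submodule O (BalancedTensor O R X Y) :=
  Submodule.span O {t | ∃ (a b : Γ) (x : X) (y : Y),
    a * b = g ∧ x ∈ 𝒳 a ∧ y ∈ 𝒴 b ∧ t = BalancedTensor.tmul O R x y}

end BalancedTensor

/-! ## Duals and graded Morita equivalences -/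

section Morita

variable {O : Type*} [CommRing O] {Γ : Type*} [Group Γ]
variable {A : Type*} [Ring A] [Algebra O A] {A' : Type*} [Ring A'] [Algebra O A']
variable {M : Type*} [AddCommGroup M] [Module O M] [Module A M] [Module A'ᵐᵒᵖ M]
  [IsScalarTower O A M] [IsScalarTower O A'ᵐᵒᵖ M] [SMulCommClass A A'ᵐᵒᵖ M]

/-- The `A`-dual `M* = Hom_A(M, A)` of an `(A, A')`-bimodule `M`, as an `(A', A)`-bimodule:
`(a' φ)(m) = φ(m a')` and `(φ a)(m) = φ(m) a`. -/
def LeftDual (A A' M : Type*) [Ring A] [Ring A'] [AddCommGroup M] [Module A M]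
    [Module A'ᵐᵒᵖ M] [SMulCommClass A A'ᵐᵒᵖ M] : Type _ := M →ₗ[A] A

instance : AddCommGroup (LeftDual A A' M) := inferInstanceAs (AddCommGroup (M →ₗ[A] A))
instance LeftDual.instModuleBase : Module O (LeftDual A A' M) :=
  inferInstanceAs (Module O (M →ₗ[A] A))
instance LeftDual.instModuleRight : Module Aᵐᵒᵖ (LeftDual A A' M) :=
  inferInstanceAs (Module Aᵐᵒᵖ (M →ₗ[A] A))
instance : FunLike (LeftDual A A' M) M A := inferInstanceAs (FunLike (M →ₗ[A] A) M A)

instance (priority := 900) LeftDual.instModuleLeft : Module A' (LeftDual A A' M) where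
  smul a' φ := LinearMap.comp (φ : M →ₗ[A] A)
    ({ toFun := fun m => op a' • m
       map_add' := smul_add (op a')
       map_smul' := fun a m => (smul_comm a (op a') m).symm } : M →ₗ[A] M)
  one_smul φ := LinearMap.ext fun m => congrArg φ (one_smul A'ᵐᵒᵖ m)
  mul_smul a b φ := LinearMap.ext fun m => congrArg φ (mul_smul (op b) (op a) m)
  smul_zero _ := LinearMap.ext fun _ => rfl
  smul_add _ _ _ := LinearMap.ext fun _ => rfl
  add_smul a b φ := LinearMap.ext fun m =>
    (congrArg φ (add_smul (op a) (op b) m)).trans (LinearMap.map_add φ _ _)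
  zero_smul φ := LinearMap.ext fun m =>
    (congrArg φ (zero_smul A'ᵐᵒᵖ m)).trans (LinearMap.map_zero φ)

theorem LeftDual.smul_apply (a' : A') (φ : LeftDual A A' M) (m : M) :
    (a' • φ) m = φ (op a' • m) := rfl

theorem LeftDual.op_smul_apply (a : A) (φ : LeftDual A A' M) (m : M) :
    (op a • φ) m = φ m * a := rfl

instance : SMulCommClass A' Aᵐᵒᵖ (LeftDual A A' M) where
  smul_comm _ _ _ := LinearMap.ext fun _ => rfl

instance : IsScalarTower O A' (LeftDual A A' M) where
  smul_assoc r a' φ := LinearMap.ext fun m =>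
    (congrArg φ (smul_assoc r (op a') m)).trans (LinearMap.map_smul_of_tower φ r _)

instance : IsScalarTower O Aᵐᵒᵖ (LeftDual A A' M) where
  smul_assoc r a φ := LinearMap.ext fun m => smul_assoc r a (φ m)

/-- The grading of the dual: `φ` has degree `g` if `φ(M_x) ⊆ A_{x g}` for all `x`. -/
def dualGrading (A' : Type*) [Ring A'] [Module A'ᵐᵒᵖ M] [SMulCommClass A A'ᵐᵒᵖ M]
    (𝒜 : Γ → Submodule O A) (ℳ : Γ → Submodule O M) (g : Γ) :
    Submodule O (LeftDual A A' M) where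
  carrier := {φ | ∀ (x : Γ) (m : M), m ∈ ℳ x → φ m ∈ 𝒜 (x * g)}
  zero_mem' _ _ _ := zero_mem _
  add_mem' h h' x m hm := add_mem (h x m hm) (h' x m hm)
  smul_mem' r _ h x m hm := Submodule.smul_mem _ r (h x m hm)

/-- The graded bimodule `M` induces a `Γ`-graded Morita equivalence between `A` and `A'`:
`M ⊗_{A'} M* ≃ A` and `M* ⊗_A M ≃ A'` as graded bimodules. (Morphisms of graded bimodules over
`C` are just the morphisms of graded bimodules.) -/
structure InducesGradedMorita (𝒜 : Γ → Submodule O A) (𝒜' : Γ → Submodule O A')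
    (ℳ : Γ → Submodule O M) : Prop where
  left : GradedBimoduleIso A A (tensorGrading A' ℳ (dualGrading A' 𝒜 ℳ)) 𝒜
  right : GradedBimoduleIso A' A' (tensorGrading A (dualGrading A' 𝒜 ℳ) ℳ) 𝒜'

end Morita

/-! ## Tensor powers -/

section TensorPower

variable (O : Type*) [CommRing O] (n : ℕ)

/-- The tensor power `M^{⊗n}` over `O`. -/
abbrev TPow (M : Type*) [AddCommGroup M] [Module O M] : Type _ := ⨂[O] _ : Fin n, M

variable {O n}
variable {C : Type*} [Ring C] [Algebra O C] {A : Type*} [Ring A] [Algebra O A]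
variable {M : Type*} [AddCommGroup M] [Module O M]

theorem TPow.induction {p : TPow O n M → Prop} (x : TPow O n M) (zero : p 0)
    (tprod : ∀ m : Fin n → M, p (PiTensorProduct.tprod O m))
    (smul : ∀ (r : O) x, p x → p (r • x)) (add : ∀ x y, p x → p y → p (x + y)) : p x := by
  have hx : x ∈ Submodule.span O (Set.range (PiTensorProduct.tprod O (s := fun _ : Fin n => M))) := by
    rw [PiTensorProduct.span_tprod_eq_top]; trivial
  induction hx using Submodule.span_induction with
  | mem x h => obtain ⟨m, rfl⟩ := h; exact tprod m
  | zero => exact zero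
  | add x y _ _ hx hy => exact add x y hx hy
  | smul r x _ hx => exact smul r x hx

/-- The left permutation action `^σ(m₁ ⊗ ⋯ ⊗ mₙ) = m_{σ⁻¹(1)} ⊗ ⋯ ⊗ m_{σ⁻¹(n)}` on `M^{⊗n}`. -/
def permAct (σ : Equiv.Perm (Fin n)) : TPow O n M ≃ₗ[O] TPow O n M :=
  PiTensorProduct.reindex O (fun _ => M) σ

theorem permAct_tprod (σ : Equiv.Perm (Fin n)) (m : Fin n → M) :
    permAct σ (PiTensorProduct.tprod O m) = PiTensorProduct.tprod O fun i => m (σ⁻¹ i) :=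
  PiTensorProduct.reindex_tprod σ m

/-- The algebra homomorphism `f^{⊗n} : C^{⊗n} → A^{⊗n}`. -/
def powHom (n : ℕ) (f : C →ₐ[O] A) : TPow O n C →ₐ[O] TPow O n A :=
  PiTensorProduct.liftAlgHom
    ((PiTensorProduct.tprod O).compLinearMap fun _ : Fin n => f.toLinearMap)
    (by
      change PiTensorProduct.tprod O (fun _ : Fin n => f 1) = _
      simp only [map_one]; rfl)
    (fun x y => by
      change PiTensorProduct.tprod O (fun i : Fin n => f (x i * y i)) =
        PiTensorProduct.tprod O (fun i => f (x i)) * PiTensorProduct.tprod O (fun i => f (y i))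
      simp only [map_mul, PiTensorProduct.tprod_mul_tprod]; rfl)

theorem powHom_tprod (f : C →ₐ[O] A) (c : Fin n → C) :
    powHom n f (PiTensorProduct.tprod O c) = PiTensorProduct.tprod O fun i => f (c i) := by
  simp [powHom]

/-- If `M` is a left `A`-module then `M^{⊗n}` is a left `A^{⊗n}`-module, componentwise. -/
instance TPow.instModule [Module A M] [IsScalarTower O A M] : Module (TPow O n A) (TPow O n M) :=
  Module.compHom _ (R := Module.End O (TPow O n M))
    ({ toFun := PiTensorProduct.map₂ fun _ : Fin n => (Algebra.lsmul O O M : A →ₐ[O] _).toLinearMap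
       map_one' := by
        refine PiTensorProduct.ext (MultilinearMap.ext fun m => ?_)
        change PiTensorProduct.map₂ _ (PiTensorProduct.tprod O 1) (PiTensorProduct.tprod O m) = _
        simp [PiTensorProduct.map₂_tprod_tprod]
       map_mul' := fun x y => by
        refine PiTensorProduct.ext (MultilinearMap.ext fun m => ?_)
        induction x using TPow.induction with
        | zero => simp
        | smul r x h => simp_all
        | add x y h h' => simp_all [add_mul]
        | tprod a =>
          induction y using TPow.induction with
          | zero => simp
          | smul r x h => simp_all
          | add x y h h' => simp_all [mul_add]
          | tprod b => simp [PiTensorProduct.map₂_tprod_tprod]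
       map_zero' := map_zero _
       map_add' := map_add _ } : TPow O n A →+* Module.End O (TPow O n M))

/-- If `M` is a right `A`-module then `M^{⊗n}` is a right `A^{⊗n}`-module, componentwise. -/
instance TPow.instModuleOp [Module Aᵐᵒᵖ M] [IsScalarTower O Aᵐᵒᵖ M] :
    Module (TPow O n A)ᵐᵒᵖ (TPow O n M) :=
  Module.compHom _ (R := Module.End O (TPow O n M))
    ({ toFun := fun x => PiTensorProduct.map₂ (fun _ : Fin n =>
        (Algebra.lsmul O O M : Aᵐᵒᵖ →ₐ[O] _).toLinearMap ∘ₗ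
          (MulOpposite.opLinearEquiv O).toLinearMap) x.unop
       map_one' := by
        refine PiTensorProduct.ext (MultilinearMap.ext fun m => ?_)
        change PiTensorProduct.map₂ _ (PiTensorProduct.tprod O 1) (PiTensorProduct.tprod O m) = _
        simp [PiTensorProduct.map₂_tprod_tprod]
       map_mul' := fun x y => by
        refine PiTensorProduct.ext (MultilinearMap.ext fun m => ?_)
        obtain ⟨x, rfl⟩ := op_surjective x
        obtain ⟨y, rfl⟩ := op_surjective y
        rw [← op_mul, unop_op, unop_op, unop_op]
        induction x using TPow.induction with
        | zero => simp
        | smul r x h => simp_all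
        | add x y h h' => simp_all [mul_add]
        | tprod a =>
          induction y using TPow.induction with
          | zero => simp
          | smul r x h => simp_all
          | add x y h h' => simp_all [add_mul]
          | tprod b => simp [PiTensorProduct.map₂_tprod_tprod]
       map_zero' := map_zero _
       map_add' := fun x y => map_add _ x.unop y.unop } :
      (TPow O n A)ᵐᵒᵖ →+* Module.End O (TPow O n M))

theorem TPow.tprod_smul_tprod [Module A M] [IsScalarTower O A M] (a : Fin n → A) (m : Fin n → M) :
    (PiTensorProduct.tprod O a : TPow O n A) • (PiTensorProduct.tprod O m : TPow O n M) =
      PiTensorProduct.tprod O fun i => a i • m i :=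
  PiTensorProduct.map₂_tprod_tprod _ a m

theorem TPow.op_tprod_smul_tprod [Module Aᵐᵒᵖ M] [IsScalarTower O Aᵐᵒᵖ M] (a : Fin n → A)
    (m : Fin n → M) :
    op (PiTensorProduct.tprod O a : TPow O n A) • (PiTensorProduct.tprod O m : TPow O n M) =
      PiTensorProduct.tprod O fun i => op (a i) • m i :=
  PiTensorProduct.map₂_tprod_tprod _ a m

end TensorPower

/-! ## Wreath products -/

/-- The wreath product of groups `Γ ≀ S_n = Γⁿ ⋊ S_n`, where `(^σ g) i = g (σ⁻¹ i)`. -/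
abbrev WreathGroup (Γ : Type*) [Group Γ] (n : ℕ) : Type _ :=
  (Fin n → Γ) ⋊[mulAutArrow] Equiv.Perm (Fin n)

section Wreath

variable {O : Type*} [CommRing O] {n : ℕ}

section Base

variable {M : Type*} [AddCommGroup M] [Module O M] {N : Type*} [AddCommGroup N] [Module O N]
variable {P : Type*} [AddCommGroup P] [Module O P]

variable (O n) in
/-- The `O`-module `M^{⊗n} ⊗ O S_n`. -/
abbrev WreathBase (M : Type*) [AddCommGroup M] [Module O M] : Type _ :=
  TPow O n M ⊗[O] MonoidAlgebra O (Equiv.Perm (Fin n))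

variable (O) in
/-- The element `(m₁ ⊗ ⋯ ⊗ mₙ) ⊗ σ`. -/
def wpure (m : Fin n → M) (σ : Equiv.Perm (Fin n)) : WreathBase O n M :=
  PiTensorProduct.tprod O m ⊗ₜ[O] MonoidAlgebra.single σ 1

theorem WreathBase.induction {p : WreathBase O n M → Prop} (x : WreathBase O n M) (zero : p 0)
    (wpure : ∀ (m : Fin n → M) σ, p (wpure O m σ))
    (smul : ∀ (r : O) x, p x → p (r • x)) (add : ∀ x y, p x → p y → p (x + y)) : p x := by
  induction x using TensorProduct.induction_on with
  | zero => exact zero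
  | add x y hx hy => exact add x y hx hy
  | tmul t f =>
    induction t using TPow.induction with
    | zero => simpa using zero
    | smul r t h => rw [← TensorProduct.smul_tmul']; exact smul _ _ h
    | add t t' h h' => rw [TensorProduct.add_tmul]; exact add _ _ h h'
    | tprod m =>
      induction f using MonoidAlgebra.induction_linear with
      | zero => simpa using zero
      | add f g h h' => rw [TensorProduct.tmul_add]; exact add _ _ h h'
      | single σ r =>
        have : MonoidAlgebra.single σ r = r • MonoidAlgebra.single σ (1 : O) := by simp
        rw [this, TensorProduct.tmul_smul]
        exact smul _ _ (wpure m σ)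

/-- The twisted product `((aᵢ) ⊗ σ)((mᵢ) ⊗ τ) = (β(aᵢ, m_{σ⁻¹(i)})) ⊗ στ` defined by a bilinear
map `β : M × N → P`; see `wmul_wpure`. -/
def wmul (β : M →ₗ[O] N →ₗ[O] P) :
    WreathBase O n M →ₗ[O] WreathBase O n N →ₗ[O] WreathBase O n P :=
  TensorProduct.lift <| LinearMap.flip <|
    (Finsupp.lsum O fun σ : Equiv.Perm (Fin n) => LinearMap.toSpanSingleton O _
      ((TensorProduct.map₂
          ((PiTensorProduct.map₂ fun _ : Fin n => β).compl₂ (permAct σ).toLinearMap)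
          (LinearMap.mul O (MonoidAlgebra O (Equiv.Perm (Fin n))))) ∘ₗ
        (TensorProduct.mk O _ _).flip (MonoidAlgebra.single σ 1))) ∘ₗ
      (MonoidAlgebra.coeffLinearEquiv O).toLinearMap

theorem wmul_wpure (β : M →ₗ[O] N →ₗ[O] P) (a : Fin n → M) (b : Fin n → N)
    (σ τ : Equiv.Perm (Fin n)) :
    wmul β (wpure O a σ) (wpure O b τ) = wpure O (fun i => β (a i) (b (σ⁻¹ i))) (σ * τ) := by
  simp [wmul, wpure, permAct_tprod, PiTensorProduct.map₂_tprod_tprod]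

variable {Q : Type*} [AddCommGroup Q] [Module O Q] {R : Type*} [AddCommGroup R] [Module O R]
  {S : Type*} [AddCommGroup S] [Module O S]

theorem wmul_assoc {β₁ : M →ₗ[O] N →ₗ[O] P} {β₂ : P →ₗ[O] Q →ₗ[O] R} {β₃ : N →ₗ[O] Q →ₗ[O] S}
    {β₄ : M →ₗ[O] S →ₗ[O] R} (h : ∀ a b c, β₂ (β₁ a b) c = β₄ a (β₃ b c))
    (x : WreathBase O n M) (y : WreathBase O n N) (z : WreathBase O n Q) :
    wmul β₂ (wmul β₁ x y) z = wmul β₄ x (wmul β₃ y z) := by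
  induction x using WreathBase.induction with
  | zero => simp
  | smul r x h => simp_all
  | add x y h h' => simp_all
  | wpure a σ =>
    induction y using WreathBase.induction with
    | zero => simp
    | smul r x h => simp_all
    | add x y h h' => simp_all
    | wpure b τ =>
      induction z using WreathBase.induction with
      | zero => simp
      | smul r x h => simp_all
      | add x y h h' => simp_all
      | wpure c π => simp [wmul_wpure, h, mul_assoc]

theorem one_wmul {β : M →ₗ[O] N →ₗ[O] N} {e : M} (h : ∀ m, β e m = m) (x : WreathBase O n N) :
    wmul β (wpure O (fun _ => e) 1) x = x := by
  induction x using WreathBase.induction with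
  | zero => simp
  | smul r x h => simp_all
  | add x y h h' => simp_all
  | wpure c π => simp [wmul_wpure, h]

theorem wmul_one {β : N →ₗ[O] M →ₗ[O] N} {e : M} (h : ∀ m, β m e = m) (x : WreathBase O n N) :
    wmul β x (wpure O (fun _ => e) 1) = x := by
  induction x using WreathBase.induction with
  | zero => simp
  | smul r x h => simp_all
  | add x y h h' => simp_all
  | wpure c π => simp [wmul_wpure, h]

end Base

variable {Γ : Type*} [Group Γ] {C : Type*} [Ring C] [Algebra O C]
variable {A : Type*} [Ring A] [Algebra O A] {A' : Type*} [Ring A'] [Algebra O A']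
variable {M : Type*} [AddCommGroup M] [Module O M] [Module A M] [Module A'ᵐᵒᵖ M]
  [IsScalarTower O A M] [IsScalarTower O A'ᵐᵒᵖ M] [SMulCommClass A A'ᵐᵒᵖ M]

variable (O n) in
/-- The wreath product algebra `A ≀ S_n = A^{⊗n} ⊗ O S_n`. -/
def WreathAlg (A : Type*) [Ring A] [Algebra O A] : Type _ := WreathBase O n A

variable (O n) in
/-- The wreath product `M ≀ S_n = M^{⊗n} ⊗ O S_n` of a bimodule `M` with `S_n`. -/
def WreathMod (M : Type*) [AddCommGroup M] [Module O M] : Type _ := WreathBase O n M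

instance : AddCommGroup (WreathAlg O n A) := inferInstanceAs (AddCommGroup (WreathBase O n A))
instance WreathAlg.instModuleBase : Module O (WreathAlg O n A) :=
  inferInstanceAs (Module O (WreathBase O n A))
instance : AddCommGroup (WreathMod O n M) := inferInstanceAs (AddCommGroup (WreathBase O n M))
instance WreathMod.instModuleBase : Module O (WreathMod O n M) :=
  inferInstanceAs (Module O (WreathBase O n M))

variable (O) in
/-- The element `(a₁ ⊗ ⋯ ⊗ aₙ) ⊗ σ` of `A ≀ S_n`. -/
def WreathAlg.pure (a : Fin n → A) (σ : Equiv.Perm (Fin n)) : WreathAlg O n A := wpure O a σ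

variable (O) in
/-- The element `(m₁ ⊗ ⋯ ⊗ mₙ) ⊗ σ` of `M ≀ S_n`. -/
def WreathMod.pure (m : Fin n → M) (σ : Equiv.Perm (Fin n)) : WreathMod O n M := wpure O m σ

instance : Ring (WreathAlg O n A) where
  __ := (inferInstance : AddCommGroup (WreathAlg O n A))
  mul x y := wmul (LinearMap.mul O A) x y
  one := WreathAlg.pure O (fun _ => 1) 1
  mul_assoc := wmul_assoc fun a b c => mul_assoc a b c
  one_mul := one_wmul fun a => one_mul a
  mul_one := wmul_one fun a => mul_one a
  left_distrib x y z := map_add (wmul (LinearMap.mul O A) x) y z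
  right_distrib x y z := LinearMap.map_add₂ (wmul (LinearMap.mul O A)) x y z
  zero_mul x := LinearMap.map_zero₂ (wmul (LinearMap.mul O A)) x
  mul_zero x := map_zero (wmul (LinearMap.mul O A) x)

instance : Algebra O (WreathAlg O n A) :=
  Algebra.ofModule (fun r x y => LinearMap.map_smul₂ (wmul (LinearMap.mul O A)) r x y)
    (fun r x y => map_smul (wmul (LinearMap.mul O A) x) r y)

theorem WreathAlg.pure_mul_pure (a b : Fin n → A) (σ τ : Equiv.Perm (Fin n)) :
    pure O a σ * pure O b τ = pure O (fun i => a i * b (σ⁻¹ i)) (σ * τ) :=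
  wmul_wpure (LinearMap.mul O A) a b σ τ

variable (O A M) in
/-- The left action `(a, m) ↦ a m` as a bilinear map. -/
def lactBilin : A →ₗ[O] M →ₗ[O] M := (Algebra.lsmul O O M : A →ₐ[O] _).toLinearMap

variable (O A' M) in
/-- The right action `(m, a') ↦ m a'` as a bilinear map. -/
def ractBilin : M →ₗ[O] A' →ₗ[O] M :=
  ((Algebra.lsmul O O M : A'ᵐᵒᵖ →ₐ[O] _).toLinearMap ∘ₗ
    (MulOpposite.opLinearEquiv O).toLinearMap).flip

instance WreathMod.instModuleLeft : Module (WreathAlg O n A) (WreathMod O n M) where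
  smul x y := wmul (lactBilin O A M) x y
  one_smul := one_wmul fun m => one_smul A m
  mul_smul := wmul_assoc fun a b m => mul_smul a b m
  smul_zero x := map_zero (wmul (lactBilin O A M) x)
  smul_add x y z := map_add (wmul (lactBilin O A M) x) y z
  add_smul x y z := LinearMap.map_add₂ (wmul (lactBilin O A M)) x y z
  zero_smul x := LinearMap.map_zero₂ (wmul (lactBilin O A M)) x

instance WreathMod.instModuleRight : Module (WreathAlg O n A')ᵐᵒᵖ (WreathMod O n M) where
  smul x y := wmul (ractBilin O A' M) y x.unop
  one_smul := wmul_one fun m => one_smul A'ᵐᵒᵖ m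
  mul_smul x y z := (wmul_assoc (β₄ := ractBilin O A' M) (β₃ := LinearMap.mul O A')
    (fun m a b => (mul_smul (op b) (op a) m).symm) z y.unop x.unop).symm
  smul_zero x := LinearMap.map_zero₂ (wmul (ractBilin O A' M)) x.unop
  smul_add x y z := LinearMap.map_add₂ (wmul (ractBilin O A' M)) y z x.unop
  add_smul x y z := map_add (wmul (ractBilin O A' M) z) x.unop y.unop
  zero_smul x := map_zero (wmul (ractBilin O A' M) x)

theorem WreathMod.pure_smul_pure (a : Fin n → A) (m : Fin n → M) (σ τ : Equiv.Perm (Fin n)) :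
    WreathAlg.pure O a σ • pure O m τ = pure O (fun i => a i • m (σ⁻¹ i)) (σ * τ) :=
  wmul_wpure (lactBilin O A M) a m σ τ

theorem WreathMod.op_pure_smul_pure (m : Fin n → M) (a' : Fin n → A')
    (τ π : Equiv.Perm (Fin n)) :
    op (WreathAlg.pure O a' π) • pure O m τ = pure O (fun i => op (a' (τ⁻¹ i)) • m i) (τ * π) :=
  wmul_wpure (ractBilin O A' M) m a' τ π

instance : SMulCommClass (WreathAlg O n A) (WreathAlg O n A')ᵐᵒᵖ (WreathMod O n M) where
  smul_comm x y m := (wmul_assoc (β₁ := lactBilin O A M) (β₂ := ractBilin O A' M)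
    (β₃ := ractBilin O A' M) (β₄ := lactBilin O A M)
    (fun a m a' => (smul_comm a (op a') m).symm) x m y.unop).symm

instance : IsScalarTower O (WreathAlg O n A) (WreathMod O n M) where
  smul_assoc r x m := LinearMap.map_smul₂ (wmul (lactBilin O A M)) r x m

instance : IsScalarTower O (WreathAlg O n A')ᵐᵒᵖ (WreathMod O n M) where
  smul_assoc r x m := map_smul (wmul (ractBilin O A' M) m) r x.unop

/-- The embedding `A^{⊗n} → A ≀ S_n`, `a ↦ a ⊗ e`, as a linear map. -/
def WreathAlg.baseLinear : TPow O n A →ₗ[O] WreathAlg O n A :=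
  (TensorProduct.mk O (TPow O n A) (MonoidAlgebra O (Equiv.Perm (Fin n)))).flip
    (MonoidAlgebra.single 1 1)

theorem WreathAlg.baseLinear_mul (x y : TPow O n A) :
    baseLinear (x * y) = baseLinear x * baseLinear y := by
  induction x using TPow.induction with
  | zero => simp
  | smul r x h => simp_all
  | add x y h h' => simp_all [add_mul]
  | tprod a =>
    induction y using TPow.induction with
    | zero => simp
    | smul r x h => simp_all
    | add x y h h' => simp_all [mul_add]
    | tprod b =>
      rw [PiTensorProduct.tprod_mul_tprod]
      exact (pure_mul_pure a b 1 1).symm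

/-- The embedding `A^{⊗n} → A ≀ S_n`, `a ↦ a ⊗ e`. -/
def WreathAlg.base : TPow O n A →ₐ[O] WreathAlg O n A :=
  AlgHom.ofLinearMap baseLinear rfl baseLinear_mul

/-- The `(g, σ)`-component `(M_{g₁} ⊗ ⋯ ⊗ M_{gₙ}) ⊗ Oσ` of `M ≀ S_n`. -/
def WreathMod.grading (n : ℕ) (ℳ : Γ → Submodule O M) (x : WreathGroup Γ n) :
    Submodule O (WreathMod O n M) :=
  Submodule.span O {t | ∃ m : Fin n → M, (∀ i, m i ∈ ℳ (x.left i)) ∧ t = pure O m x.right}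

/-- The `(g, σ)`-component `(A_{g₁} ⊗ ⋯ ⊗ A_{gₙ}) ⊗ Oσ` of `A ≀ S_n`. -/
def WreathAlg.grading (n : ℕ) (𝒜 : Γ → Submodule O A) (x : WreathGroup Γ n) :
    Submodule O (WreathAlg O n A) :=
  Submodule.span O {t | ∃ a : Fin n → A, (∀ i, a i ∈ 𝒜 (x.left i)) ∧ t = pure O a x.right}

/-- The `Γⁿ`-grading of `C^{⊗n}`, seen as a `Γ ≀ S_n`-grading that is concentrated on the
subgroup `Γⁿ`: the `(g, 1)`-component is `C_{g₁} ⊗ ⋯ ⊗ C_{gₙ}`, and the `(g, σ)`-component is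
zero for `σ ≠ 1`. -/
def powGrading (n : ℕ) (𝒞 : Γ → Submodule O C) (x : WreathGroup Γ n) :
    Submodule O (TPow O n C) :=
  Submodule.span O {t | x.right = 1 ∧ ∃ c : Fin n → C, (∀ i, c i ∈ 𝒞 (x.left i)) ∧
    t = PiTensorProduct.tprod O c}

/-- The `O`-linear automorphism `c₁ ⊗ ⋯ ⊗ cₙ ↦ ^{g₁}c_{σ⁻¹(1)} ⊗ ⋯ ⊗ ^{gₙ}c_{σ⁻¹(n)}` of `C^{⊗n}`
for `x = (g, σ)`. -/
def wreathActEquiv (ρ : Γ →* (C ≃ₐ[O] C)) (x : WreathGroup Γ n) :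
    TPow O n C ≃ₗ[O] TPow O n C :=
  (permAct x.right).trans (PiTensorProduct.congr fun i => (ρ (x.left i)).toLinearEquiv)

theorem wreathActEquiv_tprod (ρ : Γ →* (C ≃ₐ[O] C)) (x : WreathGroup Γ n) (c : Fin n → C) :
    wreathActEquiv ρ x (PiTensorProduct.tprod O c) =
      PiTensorProduct.tprod O fun i => ρ (x.left i) (c (x.right⁻¹ i)) := by
  simp [wreathActEquiv, permAct_tprod]

theorem wreathActEquiv_mul (ρ : Γ →* (C ≃ₐ[O] C)) (x : WreathGroup Γ n) (c d : TPow O n C) :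
    wreathActEquiv ρ x (c * d) = wreathActEquiv ρ x c * wreathActEquiv ρ x d := by
  induction c using TPow.induction with
  | zero => simp
  | smul r x h => simp_all
  | add x y h h' => simp_all [add_mul]
  | tprod a =>
    induction d using TPow.induction with
    | zero => simp
    | smul r x h => simp_all
    | add x y h h' => simp_all [mul_add]
    | tprod b =>
      simp only [PiTensorProduct.tprod_mul_tprod, wreathActEquiv_tprod, Pi.mul_apply, map_mul]
      rfl

/-- The action of `Γ ≀ S_n` on `C^{⊗n}`. -/
def wreathAct (n : ℕ) (ρ : Γ →* (C ≃ₐ[O] C)) : WreathGroup Γ n →* (TPow O n C ≃ₐ[O] TPow O n C) where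
  toFun x := AlgEquiv.ofLinearEquiv (wreathActEquiv ρ x)
    (by
      change wreathActEquiv ρ x (PiTensorProduct.tprod O 1) = PiTensorProduct.tprod O 1
      rw [wreathActEquiv_tprod]
      congr 1
      funext i
      simp)
    (wreathActEquiv_mul ρ x)
  map_one' := AlgEquiv.ext fun c => by
    change wreathActEquiv ρ 1 c = c
    induction c using TPow.induction with
    | zero => simp
    | smul r x h => simp_all
    | add x y h h' => simp_all
    | tprod c => simp [wreathActEquiv_tprod]
  map_mul' x y := AlgEquiv.ext fun c => by
    change wreathActEquiv ρ (x * y) c = wreathActEquiv ρ x (wreathActEquiv ρ y c)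
    induction c using TPow.induction with
    | zero => simp
    | smul r x h => simp_all
    | add x y h h' => simp_all
    | tprod c =>
      simp only [wreathActEquiv_tprod, SemidirectProduct.mul_left, SemidirectProduct.mul_right,
        Pi.mul_apply, map_mul, mul_inv_rev]
      rfl

/-- The structure map `ζ_wr : C^{⊗n} → A ≀ S_n`, `c₁ ⊗ ⋯ ⊗ cₙ ↦ (ζ(c₁) ⊗ ⋯ ⊗ ζ(cₙ)) ⊗ e`. -/
def wreathStructure (n : ℕ) (ζ : C →ₐ[O] A) : TPow O n C →ₐ[O] WreathAlg O n A :=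
  WreathAlg.base.comp (powHom n ζ)

end Wreath

/-! ## The bimodules induced from the identity component -/

section Induced

variable {O : Type*} [CommRing O] {n : ℕ} {Γ : Type*} [Group Γ] {C : Type*} [Ring C] [Algebra O C]
variable {A : Type*} [Ring A] [Algebra O A] {A' : Type*} [Ring A'] [Algebra O A']
variable {M : Type*} [AddCommGroup M] [Module O M] [Module A M] [Module A'ᵐᵒᵖ M]
  [IsScalarTower O A M] [IsScalarTower O A'ᵐᵒᵖ M] [SMulCommClass A A'ᵐᵒᵖ M]

/-- For a subalgebra `B` of `A`, `A ≀ S_n` is a left `B^{⊗n}`-module. -/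
instance WreathAlg.instModuleSubLeft (B : Subalgebra O A) :
    Module (TPow O n ↥B) (WreathAlg O n A) :=
  Module.compHom _ (WreathAlg.base.comp (powHom n B.val)).toRingHom

/-- For a subalgebra `B` of `A`, `A ≀ S_n` is a right `B^{⊗n}`-module. -/
instance WreathAlg.instModuleSubRight (B : Subalgebra O A) :
    Module (TPow O n ↥B)ᵐᵒᵖ (WreathAlg O n A) :=
  Module.compHom _ (WreathAlg.base.comp (powHom n B.val)).toRingHom.op

theorem WreathAlg.sub_smul (B : Subalgebra O A) (b : TPow O n ↥B) (α : WreathAlg O n A) :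
    b • α = base (powHom n B.val b) * α := rfl

theorem WreathAlg.sub_op_smul (B : Subalgebra O A) (b : TPow O n ↥B) (α : WreathAlg O n A) :
    op b • α = α * base (powHom n B.val b) := rfl

instance (B : Subalgebra O A) :
    SMulCommClass (WreathAlg O n A) (TPow O n ↥B)ᵐᵒᵖ (WreathAlg O n A) where
  smul_comm x _ z := (mul_assoc x z _).symm

instance (B : Subalgebra O A) :
    SMulCommClass (TPow O n ↥B) (WreathAlg O n A)ᵐᵒᵖ (WreathAlg O n A) where
  smul_comm _ y z := (mul_assoc _ z y.unop).symm

variable {ρ : Γ →* (C ≃ₐ[O] C)} {𝒜 : Γ → Submodule O A} {𝒜' : Γ → Submodule O A'}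
  {ζ : C →ₐ[O] A} {ζ' : C →ₐ[O] A'} {ℳ : Γ → Submodule O M}

/-- The canonical map `M₁^{⊗n} → M ≀ S_n`, `m₁ ⊗ ⋯ ⊗ mₙ ↦ (m₁ ⊗ ⋯ ⊗ mₙ) ⊗ e`. -/
def oneEmb (n : ℕ) (hM : IsGradedBimoduleOver ρ 𝒜 𝒜' ζ ζ' ℳ) :
    TPow O n hM.One →ₗ[O] WreathMod O n M :=
  (TensorProduct.mk O (TPow O n M) (MonoidAlgebra O (Equiv.Perm (Fin n)))).flip
    (MonoidAlgebra.single 1 1) ∘ₗ PiTensorProduct.map fun _ => hM.incl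

/-- `(A ≀ S_n) ⊗_{B^{⊗n}} M₁^{⊗n}`, where `B = A₁`. It is a left `A ≀ S_n`-module. -/
abbrev LeftInduced (n : ℕ) (hA : IsGradedAlgebra 𝒜)
    (hM : IsGradedBimoduleOver ρ 𝒜 𝒜' ζ ζ' ℳ) : Type _ :=
  BalancedTensor O (TPow O n ↥hA.oneAlg) (WreathAlg O n A) (TPow O n hM.One)

/-- `M₁^{⊗n} ⊗_{B'^{⊗n}} (A' ≀ S_n)`, where `B' = A'₁`. It is a right `A' ≀ S_n`-module. -/
abbrev RightInduced (n : ℕ) (hA' : IsGradedAlgebra 𝒜')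
    (hM : IsGradedBimoduleOver ρ 𝒜 𝒜' ζ ζ' ℳ) : Type _ :=
  BalancedTensor O (TPow O n ↥hA'.oneAlg) (TPow O n hM.One) (WreathAlg O n A')

/-- The grading of `(A ≀ S_n) ⊗_{B^{⊗n}} M₁^{⊗n}` given by the grading of `A ≀ S_n`. -/
def leftInducedGrading (n : ℕ) (hA : IsGradedAlgebra 𝒜)
    (hM : IsGradedBimoduleOver ρ 𝒜 𝒜' ζ ζ' ℳ) (x : WreathGroup Γ n) :
    Submodule O (LeftInduced n hA hM) :=
  Submodule.span O {t | ∃ α ∈ WreathAlg.grading n 𝒜 x, ∃ m : TPow O n hM.One,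
    t = BalancedTensor.tmul O _ α m}

/-- The grading of `M₁^{⊗n} ⊗_{B'^{⊗n}} (A' ≀ S_n)` given by the grading of `A' ≀ S_n`. -/
def rightInducedGrading (n : ℕ) (hA' : IsGradedAlgebra 𝒜')
    (hM : IsGradedBimoduleOver ρ 𝒜 𝒜' ζ ζ' ℳ) (x : WreathGroup Γ n) :
    Submodule O (RightInduced n hA' hM) :=
  Submodule.span O {t | ∃ (m : TPow O n hM.One), ∃ α' ∈ WreathAlg.grading n 𝒜' x,
    t = BalancedTensor.tmul O _ m α'}

/-- The right `A' ≀ S_n`-action on `(A ≀ S_n) ⊗_{B^{⊗n}} M₁^{⊗n}` induced from the `n`-th tensor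
power of the identity component: for an invertible `u` of degree `x` in `A ≀ S_n` and `a'` of
degree `x` in `A' ≀ S_n`, `(α ⊗ m) a' = α u ⊗ u⁻¹ m a'`, where `u⁻¹ m a'` is computed in
`M ≀ S_n` and lies in the image of `M₁^{⊗n}`. Since there is such a `u` in each degree, this
formula determines the action. -/
def IsInducedRight (n : ℕ) (hA : IsGradedAlgebra 𝒜) (hM : IsGradedBimoduleOver ρ 𝒜 𝒜' ζ ζ' ℳ)
    (_ : Module (WreathAlg O n A')ᵐᵒᵖ (LeftInduced n hA hM)) : Prop :=
  ∀ (x : WreathGroup Γ n) (u : (WreathAlg O n A)ˣ), (u : WreathAlg O n A) ∈ WreathAlg.grading n 𝒜 x →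
    ∀ a' ∈ WreathAlg.grading n 𝒜' x, ∀ (α : WreathAlg O n A) (m m₁ : TPow O n hM.One),
      oneEmb n hM m₁ = ((u⁻¹ : (WreathAlg O n A)ˣ) : WreathAlg O n A) • op a' • oneEmb n hM m →
      op a' • (BalancedTensor.tmul O _ α m : LeftInduced n hA hM) =
        BalancedTensor.tmul O _ (α * u) m₁

/-- The left `A ≀ S_n`-action on `M₁^{⊗n} ⊗_{B'^{⊗n}} (A' ≀ S_n)` induced from the `n`-th tensor
power of the identity component: for `a` of degree `x` in `A ≀ S_n` and an invertible `u'` of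
degree `x` in `A' ≀ S_n`, `a (m ⊗ α') = a m u'⁻¹ ⊗ u' α'`, where `a m u'⁻¹` is computed in
`M ≀ S_n` and lies in the image of `M₁^{⊗n}`. -/
def IsInducedLeft (n : ℕ) (hA' : IsGradedAlgebra 𝒜') (hM : IsGradedBimoduleOver ρ 𝒜 𝒜' ζ ζ' ℳ)
    (_ : Module (WreathAlg O n A) (RightInduced n hA' hM)) : Prop :=
  ∀ (x : WreathGroup Γ n) (u' : (WreathAlg O n A')ˣ),
    (u' : WreathAlg O n A') ∈ WreathAlg.grading n 𝒜' x →
    ∀ a ∈ WreathAlg.grading n 𝒜 x, ∀ (α' : WreathAlg O n A') (m m₁ : TPow O n hM.One),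
      oneEmb n hM m₁ = a • op ((u'⁻¹ : (WreathAlg O n A')ˣ) : WreathAlg O n A') • oneEmb n hM m →
      a • (BalancedTensor.tmul O _ m α' : RightInduced n hA' hM) =
        BalancedTensor.tmul O _ m₁ (u' * α')

end Induced

end GradedMorita
end

open scoped TensorProduct
open MulOpposite

noncomputable section

namespace GradedMorita

/-! ## Gradings and families of projections -/

section Projections

variable {O : Type*} [CommRing O] {ι : Type*} {M : Type*} [AddCommGroup M] [Module O M]

/-! Over a general commutative ring, tensor products need not preserve injections, so neither the
directness of the wreath gradings nor the injectivity of `M₁^{⊗n} → M ≀ S_n` is formal. Gradings are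
therefore handled through their finite families of `O`-linear projections. Tensor products of
projections are again projections (`IsProjFamily.wreath`), and a family of projections yields a
direct decomposition (`IsProjFamily.isInternal`). The rest of (1) comes from the associativity
`wmul_assoc`, the degree rule `wmul_mem`, and the replacement of conjugation by units with the rule
`a ζ(c) = ζ(ᵍc) a`, which is linear in `a` and can be checked on pure tensors.

Part (2) is a general fact about a crossed product `R` and a graded module `N`. A unit `u` of degree
`g` writes every `m` in `N_g` as `u (u⁻¹ m)` with `u⁻¹ m` of degree one, so `a ⊗ m ↦ a m` identifies
`R ⊗ N₁` with `N` (`exists_leftInduced_equiv`, `exists_rightInduced_equiv`). The action transported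
from `N` satisfies the prescribed formula. Conversely the formula forces the identification to be
linear on the other side, which gives uniqueness and the bimodule isomorphism together.

Part (3) never compares `(M ≀ S_n)*` with `M* ≀ S_n`. An equivalence is turned into a surjective
Morita context: two pairings with an abstract module `N`, associative with each other and both
reaching `1`. The given isomorphisms are unrelated, so their pairings associate only up to an
endomorphism of `M`, which has to be corrected (`exists_isSurjectiveContext`). A context consists of
equations, so it passes to wreath products (`IsSurjectiveContext.wreath`). Finally a context makes
evaluation `M ⊗ M* → A` bijective, as well as the map `M* ⊗ M → A'` characterised by `m B(φ, m') =
φ(m) m'`. Both maps respect degrees automatically, so they are graded isomorphisms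
(`IsSurjectiveContext.inducesGradedMorita`). -/

/-- `p` is the family of projections onto the components of the grading `ℳ` of `M`. -/
structure IsProjFamily [Fintype ι] (ℳ : ι → Submodule O M) (p : ι → M →ₗ[O] M) : Prop where
  mem : ∀ g m, p g m ∈ ℳ g
  sum : ∀ m, ∑ g, p g m = m
  of_ne : ∀ {g h m}, m ∈ ℳ h → h ≠ g → p g m = 0

theorem IsProjFamily.of_mem [Fintype ι] {ℳ : ι → Submodule O M} {p : ι → M →ₗ[O] M}
    (hp : IsProjFamily ℳ p) {g : ι} {m : M} (hm : m ∈ ℳ g) : p g m = m := by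
  conv_rhs => rw [← hp.sum m]
  rw [Finset.sum_eq_single g]
  · exact fun h _ hne => hp.of_ne hm hne.symm
  · simp

theorem exists_isProjFamily [Fintype ι] [DecidableEq ι] {ℳ : ι → Submodule O M}
    (h : DirectSum.IsInternal ℳ) : ∃ p : ι → M →ₗ[O] M, IsProjFamily ℳ p := by
  let := h.chooseDecomposition
  refine ⟨fun g => (ℳ g).subtype ∘ₗ DirectSum.component O ι (fun i => ℳ i) g ∘ₗ
    (DirectSum.decomposeLinearEquiv ℳ).toLinearMap, fun g m => Submodule.coe_mem _, fun m => ?_,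
    fun {g h m} hm hne => ?_⟩
  · classical
    conv_rhs => rw [← DirectSum.sum_support_decompose ℳ m]
    refine (Finset.sum_subset (Finset.subset_univ _) fun g _ hg => ?_).symm
    change ((DirectSum.decompose ℳ m g : ℳ g) : M) = 0
    simpa using hg
  · exact DirectSum.decompose_of_mem_ne ℳ hm hne

/-- The sum of the projections, read in the external direct sum, is a two-sided inverse of the
canonical map. Directness is always proved this way below, which avoids any flatness assumption. -/
theorem IsProjFamily.isInternal [Fintype ι] [DecidableEq ι] {ℳ : ι → Submodule O M}
    {p : ι → M →ₗ[O] M} (hp : IsProjFamily ℳ p) : DirectSum.IsInternal ℳ := by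
  let : DirectSum.Decomposition ℳ := DirectSum.Decomposition.ofLinearMap ℳ
    (∑ g, DirectSum.lof O ι (fun i => ℳ i) g ∘ₗ (p g).codRestrict (ℳ g) (hp.mem g))
    (by
      ext m
      simp only [LinearMap.comp_apply, LinearMap.sum_apply, map_sum, DirectSum.coeLinearMap_lof]
      simpa using hp.sum m)
    (by
      refine DirectSum.linearMap_ext _ fun h => LinearMap.ext fun m => ?_
      simp only [LinearMap.comp_apply, LinearMap.sum_apply, DirectSum.coeLinearMap_lof]
      rw [Finset.sum_eq_single h]
      · exact congrArg _ (Subtype.ext (hp.of_mem m.2))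
      · intro g _ hg
        have : (p g).codRestrict (ℳ g) (hp.mem g) m = 0 := Subtype.ext (hp.of_ne m.2 hg.symm)
        rw [this, map_zero]
      · simp)
  exact DirectSum.Decomposition.isInternal ℳ

theorem IsProjFamily.mem_of_eq_zero [Fintype ι] {ℳ : ι → Submodule O M} {p : ι → M →ₗ[O] M}
    (hp : IsProjFamily ℳ p) {g : ι} {m : M} (h : ∀ k, k ≠ g → p k m = 0) : m ∈ ℳ g := by
  have : p g m = m := by
    conv_rhs => rw [← hp.sum m]
    rw [Finset.sum_eq_single g]
    · exact fun k _ hk => h k hk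
    · simp
  exact this ▸ hp.mem g m

/-- A surjection that is compatible with gradings maps components onto components. -/
theorem map_grading_eq [Finite ι] {_ : DecidableEq ι} {N : Type*} [AddCommGroup N] [Module O N]
    {ℳ : ι → Submodule O M} {𝒩 : ι → Submodule O N} (h𝒩 : DirectSum.IsInternal 𝒩)
    (htop : ⨆ g, ℳ g = ⊤) (f : M →ₗ[O] N) (hf : Function.Surjective f)
    (hmem : ∀ g, ∀ m ∈ ℳ g, f m ∈ 𝒩 g) (g : ι) : (ℳ g).map f = 𝒩 g := by
  have := Fintype.ofFinite ι
  obtain ⟨p, hp⟩ := exists_isProjFamily h𝒩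
  refine le_antisymm (Submodule.map_le_iff_le_comap.mpr (hmem g)) fun x hx => ?_
  -- If `m` has degree `h`, then `p g (f m)` is `f m` or `0` according to whether `h = g`. Applied
  -- to an arbitrary preimage of `x`, this yields a preimage of degree `g`.
  have key : ∀ m : M, p g (f m) ∈ (ℳ g).map f := fun m => by
    have hm : m ∈ ⨆ g, ℳ g := htop ▸ trivial
    induction hm using Submodule.iSup_induction' with
    | mem h m hm =>
      by_cases e : h = g
      · subst e
        rw [hp.of_mem (hmem _ m hm)]
        exact Submodule.mem_map_of_mem hm
      · rw [hp.of_ne (hmem _ m hm) e]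
        exact zero_mem _
    | zero => simp
    | add x y _ _ hx hy => rw [map_add, map_add]; exact add_mem hx hy
  obtain ⟨m, rfl⟩ := hf x
  exact hp.of_mem hx ▸ key m

end Projections

/-! ### Units and the commutation rule in crossed products -/

section Basic

variable {O : Type*} [CommRing O] {Γ : Type*} [Group Γ]
variable {C : Type*} [Ring C] [Algebra O C] {A : Type*} [Ring A] [Algebra O A]

/-- Multiplication by `u` carries the `k`-th projection to the `(g k)`-th. Hence `u` times the
`k`-part of `u⁻¹` is the `(g k)`-part of `1`, which vanishes unless `k = g⁻¹`. -/
theorem IsGradedAlgebra.inv_mem [Finite Γ] {𝒜 : Γ → Submodule O A} (hA : IsGradedAlgebra 𝒜)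
    {g : Γ} {u : Aˣ} (hu : (u : A) ∈ 𝒜 g) : ((u⁻¹ : Aˣ) : A) ∈ 𝒜 g⁻¹ := by
  classical
  have := Fintype.ofFinite Γ
  obtain ⟨p, hp⟩ := exists_isProjFamily hA.isInternal
  refine hp.mem_of_eq_zero fun k hk => ?_
  have hmul : ∀ a, p (g * k) (u * a) = u * p k a := fun a => by
    conv_lhs => rw [← hp.sum a, Finset.mul_sum, map_sum]
    rw [Finset.sum_eq_single k]
    · exact hp.of_mem (hA.mul_mem hu (hp.mem _ _))
    · exact fun h _ hh => hp.of_ne (hA.mul_mem hu (hp.mem _ _)) (by simpa using hh)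
    · simp
  have h0 : (u : A) * p k ((u⁻¹ : Aˣ) : A) = 0 := by
    rw [← hmul, Units.mul_inv]
    refine hp.of_ne hA.one_mem fun h => hk ?_
    rw [eq_inv_of_mul_eq_one_right h.symm]
  simpa using congrArg (((u⁻¹ : Aˣ) : A) * ·) h0

/-- For a unit `u` of degree `g`, the element `a u⁻¹` lies in `A₁` and so commutes with `ζ(ᵍc) = u
ζ(c) u⁻¹`. This extends the conjugation rule from units to all homogeneous elements. -/
theorem IsCrossedProductOver.mul_map [Finite Γ] {𝒞 : Γ → Submodule O C} {ρ : Γ →* (C ≃ₐ[O] C)}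
    {𝒜 : Γ → Submodule O A} {ζ : C →ₐ[O] A} (hA : IsCrossedProductOver 𝒞 ρ 𝒜 ζ) {g : Γ} {a : A}
    (ha : a ∈ 𝒜 g) (c : C) : a * ζ c = ζ (ρ g c) * a := by
  obtain ⟨u, hu⟩ := hA.exists_unit g
  have h1 : a * ((u⁻¹ : Aˣ) : A) ∈ 𝒜 1 := by
    simpa using hA.mul_mem ha (hA.toIsGradedAlgebra.inv_mem hu)
  have h2 := (Subalgebra.mem_centralizer_iff O).mp (hA.map_mem_centralizer (ρ g c)) _ h1
  rw [hA.map_act g c u hu] at h2 ⊢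
  calc a * ζ c = a * ((u⁻¹ : Aˣ) : A) * (u * ζ c * ((u⁻¹ : Aˣ) : A)) * u := by
        simp [mul_assoc]
    _ = _ := by rw [h2]; simp [mul_assoc]

/-- To check that a graded algebra is a crossed product over `C`, it suffices to check the
commutation rule `a ζ(c) = ζ(ᵍc) a`. -/
theorem IsCrossedProductOver.of_mul_map {𝒞 : Γ → Submodule O C} {ρ : Γ →* (C ≃ₐ[O] C)}
    {𝒜 : Γ → Submodule O A} {ζ : C →ₐ[O] A} (hA : IsCrossedProduct 𝒜)
    (hmem : ∀ {h : Γ} {c : C}, c ∈ 𝒞 h → ζ c ∈ 𝒜 h)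
    (hmul : ∀ (g : Γ) (c : C), ∀ a ∈ 𝒜 g, a * ζ c = ζ (ρ g c) * a) :
    IsCrossedProductOver 𝒞 ρ 𝒜 ζ where
  toIsCrossedProduct := hA
  map_mem_centralizer c := (Subalgebra.mem_centralizer_iff O).mpr fun a ha => by
    simpa using hmul 1 c a ha
  map_mem := hmem
  map_act g c u hu := by rw [hmul g c u hu, mul_assoc, Units.mul_inv, mul_one]

end Basic

/-! ## Gradings of wreath products -/

section WreathGrading

variable {O : Type*} [CommRing O] {n : ℕ} {Γ : Type*} [Group Γ]
variable {M : Type*} [AddCommGroup M] [Module O M]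

instance [Finite Γ] : Finite (WreathGroup Γ n) := Finite.of_equiv _ SemidirectProduct.equivProd.symm

variable (M) in
/-- The map `t ↦ t ⊗ σ`. -/
def wincl (σ : Equiv.Perm (Fin n)) : TPow O n M →ₗ[O] WreathBase O n M :=
  (TensorProduct.mk O (TPow O n M) (MonoidAlgebra O (Equiv.Perm (Fin n)))).flip
    (MonoidAlgebra.single σ 1)

theorem wincl_tprod (σ : Equiv.Perm (Fin n)) (m : Fin n → M) :
    wincl M σ (PiTensorProduct.tprod O m) = wpure O m σ := rfl

variable (M) in
/-- The coefficient of `σ` in an element of `M^{⊗n} ⊗ O S_n`. -/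
def wcoeff (σ : Equiv.Perm (Fin n)) : WreathBase O n M →ₗ[O] TPow O n M :=
  (TensorProduct.rid O (TPow O n M)).toLinearMap ∘ₗ
    LinearMap.lTensor _ (Finsupp.lapply σ ∘ₗ (MonoidAlgebra.coeffLinearEquiv O).toLinearMap)

theorem wcoeff_wpure (σ τ : Equiv.Perm (Fin n)) (m : Fin n → M) :
    wcoeff M σ (wpure O m τ) = if τ = σ then PiTensorProduct.tprod O m else 0 := by
  simp [wcoeff, wpure, Finsupp.single_apply, ite_smul]

variable (n) in
/-- The grading of `M^{⊗n} ⊗ O S_n` by the wreath product group. -/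
def wgrading (ℳ : Γ → Submodule O M) (x : WreathGroup Γ n) : Submodule O (WreathBase O n M) :=
  Submodule.span O {t | ∃ m : Fin n → M, (∀ i, m i ∈ ℳ (x.left i)) ∧ t = wpure O m x.right}

theorem wpure_mem_wgrading {ℳ : Γ → Submodule O M} {x : WreathGroup Γ n} {m : Fin n → M}
    (hm : ∀ i, m i ∈ ℳ (x.left i)) {σ : Equiv.Perm (Fin n)} (hσ : σ = x.right) :
    wpure O m σ ∈ wgrading n ℳ x :=
  Submodule.subset_span ⟨m, hm, by rw [hσ]⟩

theorem tprod_mem_powGrading {C : Type*} [Ring C] [Algebra O C] {𝒞 : Γ → Submodule O C}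
    {x : WreathGroup Γ n} {c : Fin n → C} (hc : ∀ i, c i ∈ 𝒞 (x.left i)) (hx : x.right = 1) :
    PiTensorProduct.tprod O c ∈ powGrading n 𝒞 x :=
  Submodule.subset_span ⟨hx, c, hc, rfl⟩

theorem sum_map_tprod {ι : Type*} [Fintype ι] {p : ι → M →ₗ[O] M} (hp : ∀ m, ∑ g, p g m = m)
    (m : Fin n → M) :
    ∑ g : Fin n → ι, PiTensorProduct.tprod O (fun i => p (g i) (m i)) =
      PiTensorProduct.tprod O m := by
  rw [← MultilinearMap.map_sum (PiTensorProduct.tprod O) fun i g => p g (m i)]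
  simp only [hp]

/-- The projections of `M^{⊗n} ⊗ O S_n` onto its components. -/
def wproj (p : Γ → M →ₗ[O] M) (x : WreathGroup Γ n) : WreathBase O n M →ₗ[O] WreathBase O n M :=
  wincl M x.right ∘ₗ PiTensorProduct.map (fun i => p (x.left i)) ∘ₗ wcoeff M x.right

theorem wproj_wpure (p : Γ → M →ₗ[O] M) (x : WreathGroup Γ n) (m : Fin n → M)
    (σ : Equiv.Perm (Fin n)) :
    wproj p x (wpure O m σ) =
      if σ = x.right then wpure O (fun i => p (x.left i) (m i)) σ else 0 := by
  rw [wproj, LinearMap.comp_apply, LinearMap.comp_apply, wcoeff_wpure]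
  split_ifs with h
  · rw [PiTensorProduct.map_tprod, wincl_tprod, h]
  · simp

theorem tprod_eq_zero_of {m : Fin n → M} {i : Fin n} (h : m i = 0) :
    PiTensorProduct.tprod O m = 0 := (PiTensorProduct.tprod O).map_coord_zero i h

/-- The projection for `(g, σ)` extracts the coefficient of `σ` and applies `p (g i)` in the `i`-th
tensor factor. That these sum to the identity is the multilinear expansion of `m i = ∑ g, p g (m
i)`. -/
theorem IsProjFamily.wreath [Fintype Γ] [Fintype (WreathGroup Γ n)] {ℳ : Γ → Submodule O M}
    {p : Γ → M →ₗ[O] M} (hp : IsProjFamily ℳ p) :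
    IsProjFamily (wgrading n ℳ) (wproj (n := n) p) where
  mem x t := by
    induction t using WreathBase.induction with
    | zero => simp
    | smul r t h => rw [map_smul]; exact Submodule.smul_mem _ _ h
    | add t t' h h' => rw [map_add]; exact add_mem h h'
    | wpure m σ =>
      rw [wproj_wpure]
      split_ifs with h
      · exact wpure_mem_wgrading (fun i => hp.mem _ _) h
      · exact zero_mem _
  sum t := by
    induction t using WreathBase.induction with
    | zero => simp
    | smul r t h => simp only [map_smul, ← Finset.smul_sum, h]
    | add t t' h h' => simp only [map_add, Finset.sum_add_distrib, h, h']
    | wpure m σ =>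
      simp only [wproj_wpure]
      rw [← Equiv.sum_comp (SemidirectProduct.equivProd (φ := mulAutArrow)
        (N := Fin n → Γ) (G := Equiv.Perm (Fin n))).symm, Fintype.sum_prod_type_right]
      rw [Finset.sum_eq_single σ]
      · simp only [SemidirectProduct.equivProd, Equiv.coe_fn_symm_mk, if_true, wpure,
          ← TensorProduct.sum_tmul, sum_map_tprod hp.sum]
      · exact fun τ _ hτ => Finset.sum_eq_zero fun g _ => if_neg hτ.symm
      · simp
  of_ne {x y t} ht hne := by
    induction ht using Submodule.span_induction with
    | zero => simp
    | smul r t _ h => rw [map_smul, h, smul_zero]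
    | add t t' _ _ h h' => rw [map_add, h, h', add_zero]
    | mem t ht =>
      obtain ⟨m, hm, rfl⟩ := ht
      rw [wproj_wpure]
      split_ifs with h
      -- With equal permutations the two degree tuples differ at some index, and the projection
      -- kills the tensor factor there.
      · have : x.left ≠ y.left := fun e => hne (SemidirectProduct.ext e.symm h)
        obtain ⟨i, hi⟩ := Function.ne_iff.mp this
        rw [wpure, tprod_eq_zero_of (i := i) (hp.of_ne (hm i) hi.symm), TensorProduct.zero_tmul]
      · rfl

theorem wgrading_isInternal [Finite Γ] {_ : DecidableEq Γ} {_ : DecidableEq (WreathGroup Γ n)}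
    {ℳ : Γ → Submodule O M} (h : DirectSum.IsInternal ℳ) :
    DirectSum.IsInternal (wgrading n ℳ) := by
  have := Fintype.ofFinite Γ
  have := Fintype.ofFinite (WreathGroup Γ n)
  obtain ⟨p, hp⟩ := exists_isProjFamily h
  exact hp.wreath.isInternal

/-- The projections are tensor products of those of `C` on the subgroup `Γⁿ`, and zero outside it,
where the components vanish. -/
theorem powGrading_isInternal [Finite Γ] {_ : DecidableEq Γ} {_ : DecidableEq (WreathGroup Γ n)}
    {C : Type*} [Ring C] [Algebra O C]
    {𝒞 : Γ → Submodule O C} (h : DirectSum.IsInternal 𝒞) :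
    DirectSum.IsInternal (powGrading n 𝒞) := by
  have := Fintype.ofFinite Γ
  have := Fintype.ofFinite (WreathGroup Γ n)
  obtain ⟨p, hp⟩ := exists_isProjFamily h
  have hq : ∀ (x : WreathGroup Γ n) (c : Fin n → C),
      (if x.right = 1 then PiTensorProduct.map (fun i => p (x.left i)) else 0 :
        TPow O n C →ₗ[O] TPow O n C) (PiTensorProduct.tprod O c) =
        if x.right = 1 then PiTensorProduct.tprod O (fun i => p (x.left i) (c i)) else 0 := by
    intro x c
    split_ifs <;> simp
  refine IsProjFamily.isInternal (p := fun x => if x.right = 1 then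
    PiTensorProduct.map (fun i => p (x.left i)) else 0) ⟨fun x t => ?_, fun t => ?_,
    fun {x y t} ht hne => ?_⟩
  · induction t using TPow.induction with
    | zero => simp
    | smul r t h => rw [map_smul]; exact Submodule.smul_mem _ _ h
    | add t t' h h' => rw [map_add]; exact add_mem h h'
    | tprod c =>
      rw [hq]
      split_ifs with h
      · exact tprod_mem_powGrading (fun i => hp.mem _ _) h
      · exact zero_mem _
  · induction t using TPow.induction with
    | zero => simp
    | smul r t h => simp only [map_smul, ← Finset.smul_sum, h]
    | add t t' h h' => simp only [map_add, Finset.sum_add_distrib, h, h']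
    | tprod c =>
      simp only [hq]
      rw [← Equiv.sum_comp (SemidirectProduct.equivProd (φ := mulAutArrow)
        (N := Fin n → Γ) (G := Equiv.Perm (Fin n))).symm, Fintype.sum_prod_type_right]
      rw [Finset.sum_eq_single 1]
      · simp only [SemidirectProduct.equivProd, Equiv.coe_fn_symm_mk, if_true,
          sum_map_tprod hp.sum]
      · exact fun τ _ hτ => Finset.sum_eq_zero fun g _ => if_neg hτ
      · simp
  · induction ht using Submodule.span_induction with
    | zero => simp
    | smul r t _ h => rw [map_smul, h, smul_zero]
    | add t t' _ _ h h' => rw [map_add, h, h', add_zero]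
    | mem t ht =>
      obtain ⟨hy, c, hc, rfl⟩ := ht
      rw [hq]
      split_ifs with h
      · have : x.left ≠ y.left := fun e => hne (SemidirectProduct.ext e.symm (hy.trans h.symm))
        obtain ⟨i, hi⟩ := Function.ne_iff.mp this
        rw [tprod_eq_zero_of (i := i) (hp.of_ne (hc i) hi.symm)]
      · rfl

end WreathGrading

/-! ## The wreath product as a graded bimodule -/

section WreathBimodule

variable {O : Type*} [CommRing O] {n : ℕ} {Γ : Type*} [Group Γ]

section Base

variable {M : Type*} [AddCommGroup M] [Module O M] {N : Type*} [AddCommGroup N] [Module O N]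
variable {P : Type*} [AddCommGroup P] [Module O P]

/-- The `i`-th factor of a product has degree `x.left i * y.left (x.right⁻¹ i)`, which is `(x *
y).left i` in the semidirect product. A general `β` covers the multiplication and both actions at
once. -/
theorem wmul_mem {ℳ : Γ → Submodule O M} {𝒩 : Γ → Submodule O N} {𝒬 : Γ → Submodule O P}
    {β : M →ₗ[O] N →ₗ[O] P}
    (hβ : ∀ {g h : Γ} {a : M} {b : N}, a ∈ ℳ g → b ∈ 𝒩 h → β a b ∈ 𝒬 (g * h))
    {x y : WreathGroup Γ n} {s : WreathBase O n M} {t : WreathBase O n N}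
    (hs : s ∈ wgrading n ℳ x) (ht : t ∈ wgrading n 𝒩 y) :
    wmul β s t ∈ wgrading n 𝒬 (x * y) := by
  induction hs using Submodule.span_induction with
  | zero => simp
  | smul r s _ h => rw [map_smul, LinearMap.smul_apply]; exact Submodule.smul_mem _ _ h
  | add s s' _ _ h h' => rw [map_add, LinearMap.add_apply]; exact add_mem h h'
  | mem s hs =>
    obtain ⟨a, ha, rfl⟩ := hs
    induction ht using Submodule.span_induction with
    | zero => simp
    | smul r s _ h => rw [map_smul]; exact Submodule.smul_mem _ _ h
    | add s s' _ _ h h' => rw [map_add]; exact add_mem h h'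
    | mem t ht =>
      obtain ⟨b, hb, rfl⟩ := ht
      rw [wmul_wpure]
      exact wpure_mem_wgrading (fun i => hβ (ha i) (hb _)) rfl

theorem tprod_sum {ι : Type*} [Fintype ι] (f : Fin n → ι → M) :
    PiTensorProduct.tprod O (fun i => ∑ j, f i j) =
      ∑ J : Fin n → ι, PiTensorProduct.tprod O (fun i => f i (J i)) :=
  MultilinearMap.map_sum (PiTensorProduct.tprod O) f

theorem wpure_sum {ι : Type*} [Fintype ι] (f : Fin n → ι → M) (σ : Equiv.Perm (Fin n)) :
    wpure O (fun i => ∑ j, f i j) σ = ∑ J : Fin n → ι, wpure O (fun i => f i (J i)) σ := by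
  simp only [wpure, tprod_sum, TensorProduct.sum_tmul]

end Base

variable {C : Type*} [Ring C] [Algebra O C]
variable {A : Type*} [Ring A] [Algebra O A] {A' : Type*} [Ring A'] [Algebra O A']
variable {M : Type*} [AddCommGroup M] [Module O M] [Module A M] [Module A'ᵐᵒᵖ M]
  [IsScalarTower O A M] [IsScalarTower O A'ᵐᵒᵖ M] [SMulCommClass A A'ᵐᵒᵖ M]

theorem WreathMod.induction {p : WreathMod O n M → Prop} (x : WreathMod O n M) (zero : p 0)
    (pure : ∀ (m : Fin n → M) σ, p (pure O m σ))
    (smul : ∀ (r : O) x, p x → p (r • x)) (add : ∀ x y, p x → p y → p (x + y)) : p x :=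
  WreathBase.induction x zero pure smul add

theorem WreathAlg.induction {p : WreathAlg O n A → Prop} (x : WreathAlg O n A) (zero : p 0)
    (pure : ∀ (m : Fin n → A) σ, p (pure O m σ))
    (smul : ∀ (r : O) x, p x → p (r • x)) (add : ∀ x y, p x → p y → p (x + y)) : p x :=
  WreathBase.induction x zero pure smul add

theorem WreathAlg.base_tprod (a : Fin n → A) :
    base (PiTensorProduct.tprod O a) = pure O a 1 := rfl

theorem wreathStructure_tprod (ζ : C →ₐ[O] A) (c : Fin n → C) :
    wreathStructure n ζ (PiTensorProduct.tprod O c) = WreathAlg.pure O (fun i => ζ (c i)) 1 := by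
  rw [wreathStructure, AlgHom.comp_apply, powHom_tprod, WreathAlg.base_tprod]

theorem wreathAct_tprod (ρ : Γ →* (C ≃ₐ[O] C)) (x : WreathGroup Γ n) (c : Fin n → C) :
    wreathAct n ρ x (PiTensorProduct.tprod O c) =
      PiTensorProduct.tprod O fun i => ρ (x.left i) (c (x.right⁻¹ i)) :=
  wreathActEquiv_tprod ρ x c

theorem powGrading_isGradedActedAlgebra [Finite Γ] (n : ℕ) {𝒞 : Γ → Submodule O C}
    {ρ : Γ →* (C ≃ₐ[O] C)} (hC : IsGradedActedAlgebra 𝒞 ρ) :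
    IsGradedActedAlgebra (powGrading n 𝒞) (wreathAct n ρ) where
  isInternal := powGrading_isInternal hC.isInternal
  one_mem := tprod_mem_powGrading (c := fun _ => 1) (fun _ => hC.one_mem) rfl
  mul_mem {x y s t} hs ht := by
    induction hs using Submodule.span_induction with
    | zero => simp
    | smul r s _ h => rw [smul_mul_assoc]; exact Submodule.smul_mem _ _ h
    | add s s' _ _ h h' => rw [add_mul]; exact add_mem h h'
    | mem s hs =>
      obtain ⟨hx, c, hc, rfl⟩ := hs
      induction ht using Submodule.span_induction with
      | zero => simp
      | smul r s _ h => rw [mul_smul_comm]; exact Submodule.smul_mem _ _ h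
      | add s s' _ _ h h' => rw [mul_add]; exact add_mem h h'
      | mem t ht =>
        obtain ⟨hy, d, hd, rfl⟩ := ht
        rw [PiTensorProduct.tprod_mul_tprod]
        refine tprod_mem_powGrading (fun i => ?_) (by simp [hx, hy])
        have := hC.mul_mem (hc i) (hd i)
        simpa [hx] using this
  act_mem {x y t} ht := by
    induction ht using Submodule.span_induction with
    | zero => simp
    | smul r s _ h => rw [map_smul]; exact Submodule.smul_mem _ _ h
    | add s s' _ _ h h' => rw [map_add]; exact add_mem h h'
    | mem t ht =>
      obtain ⟨hy, c, hc, rfl⟩ := ht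
      rw [wreathAct_tprod]
      refine tprod_mem_powGrading (fun i => ?_) (by simp [hy])
      have := hC.act_mem (g := x.left i) (hc (x.right⁻¹ i))
      -- Since `y` has trivial permutation part, the twists by `x.right` and its inverse cancel on
      -- the factor coming from `x⁻¹`.
      have e : (x * y * x⁻¹).left i = x.left i * y.left (x.right⁻¹ i) * (x.left i)⁻¹ := by
        rw [SemidirectProduct.mul_left, SemidirectProduct.mul_left, SemidirectProduct.mul_right, hy,
          mul_one, SemidirectProduct.inv_left, ← MulAut.mul_apply, ← map_mul, mul_inv_cancel]
        rw [map_one]; rfl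
      rwa [e]

theorem WreathAlg.pure_mem_grading {𝒜 : Γ → Submodule O A} {x : WreathGroup Γ n} {a : Fin n → A}
    (ha : ∀ i, a i ∈ 𝒜 (x.left i)) : pure O a x.right ∈ grading n 𝒜 x :=
  Submodule.subset_span ⟨a, ha, rfl⟩

theorem WreathAlg.one_def : (1 : WreathAlg O n A) = pure O (fun _ => 1) 1 := rfl

theorem WreathAlg.mul_mem_grading {𝒜 : Γ → Submodule O A}
    (hA : IsGradedAlgebra 𝒜) {x y : WreathGroup Γ n} {s t : WreathAlg O n A}
    (hs : s ∈ grading n 𝒜 x) (ht : t ∈ grading n 𝒜 y) : s * t ∈ grading n 𝒜 (x * y) :=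
  wmul_mem (β := LinearMap.mul O A) (𝒬 := 𝒜) (fun ha hb => hA.mul_mem ha hb) hs ht

theorem WreathAlg.grading_isInternal [Finite Γ] {_ : DecidableEq Γ}
    {_ : DecidableEq (WreathGroup Γ n)} {𝒜 : Γ → Submodule O A}
    (hA : DirectSum.IsInternal 𝒜) : DirectSum.IsInternal (grading n 𝒜) :=
  wgrading_isInternal hA

theorem wreathAlg_isGradedAlgebra [Finite Γ] (n : ℕ) {𝒜 : Γ → Submodule O A}
    (hA : IsGradedAlgebra 𝒜) : IsGradedAlgebra (WreathAlg.grading n 𝒜) where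
  isInternal := WreathAlg.grading_isInternal hA.isInternal
  one_mem := by
    rw [WreathAlg.one_def]
    exact WreathAlg.pure_mem_grading (x := 1) fun _ => hA.one_mem
  mul_mem hs ht := WreathAlg.mul_mem_grading hA hs ht

theorem wreathAlg_isCrossedProduct [Finite Γ] (n : ℕ) {𝒜 : Γ → Submodule O A}
    (hA : IsCrossedProduct 𝒜) : IsCrossedProduct (WreathAlg.grading n 𝒜) where
  toIsGradedAlgebra := wreathAlg_isGradedAlgebra n hA.toIsGradedAlgebra
  exists_unit x := by
    choose u hu using fun i => hA.exists_unit (x.left i)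
    -- In the twisted product, place `i` of the first factor meets place `σ⁻¹ i` of the second, so
    -- the inverse must carry the inverse of `u (σ i)` in place `i`.
    refine ⟨⟨WreathAlg.pure O (fun i => (u i : A)) x.right,
      WreathAlg.pure O (fun i => ((u (x.right i))⁻¹ : Aˣ)) x.right⁻¹, ?_, ?_⟩,
      WreathAlg.pure_mem_grading hu⟩
    · rw [WreathAlg.pure_mul_pure]
      simp; rfl
    · rw [WreathAlg.pure_mul_pure]
      simp; rfl

theorem wreathAlg_isCrossedProductOver [Finite Γ] (n : ℕ) {𝒞 : Γ → Submodule O C}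
    {ρ : Γ →* (C ≃ₐ[O] C)} {𝒜 : Γ → Submodule O A} {ζ : C →ₐ[O] A}
    (hA : IsCrossedProductOver 𝒞 ρ 𝒜 ζ) :
    IsCrossedProductOver (powGrading n 𝒞) (wreathAct n ρ) (WreathAlg.grading n 𝒜)
      (wreathStructure n ζ) := by
  -- A unit of a wreath component need not be a pure tensor. The commutation rule is linear in the
  -- homogeneous element, so spanning pure tensors suffice.
  refine .of_mul_map (wreathAlg_isCrossedProduct n hA.toIsCrossedProduct) (fun {x c} hc => ?_)
    fun x c a ha => ?_
  · induction hc using Submodule.span_induction with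
    | zero => simp
    | smul r s _ h => rw [map_smul]; exact Submodule.smul_mem _ _ h
    | add s s' _ _ h h' => rw [map_add]; exact add_mem h h'
    | mem t ht =>
      obtain ⟨hx, c, hc, rfl⟩ := ht
      rw [wreathStructure_tprod, ← hx]
      exact WreathAlg.pure_mem_grading fun i => hA.map_mem (hc i)
  · induction ha using Submodule.span_induction with
    | zero => simp
    | smul r s _ h => rw [smul_mul_assoc, h, mul_smul_comm]
    | add s s' _ _ h h' => rw [add_mul, h, h', mul_add]
    | mem t ht =>
      obtain ⟨a, ha, rfl⟩ := ht
      induction c using TPow.induction with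
      | zero => simp
      | smul r s h => rw [map_smul, mul_smul_comm, h, map_smul, map_smul, smul_mul_assoc]
      | add s s' h h' => rw [map_add, mul_add, h, h', map_add, map_add, add_mul]
      | tprod c =>
        rw [wreathAct_tprod, wreathStructure_tprod, wreathStructure_tprod,
          WreathAlg.pure_mul_pure, WreathAlg.pure_mul_pure, mul_one, one_mul]
        congr 1
        funext i
        exact hA.mul_map (ha i) _

theorem wreathMod_isGradedBimoduleOver [Finite Γ] (n : ℕ)
    {ρ : Γ →* (C ≃ₐ[O] C)} {𝒜 : Γ → Submodule O A} {ζ : C →ₐ[O] A}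
    {𝒜' : Γ → Submodule O A'} {ζ' : C →ₐ[O] A'} {ℳ : Γ → Submodule O M}
    (hM : IsGradedBimoduleOver ρ 𝒜 𝒜' ζ ζ' ℳ) :
    IsGradedBimoduleOver (wreathAct n ρ) (WreathAlg.grading n 𝒜) (WreathAlg.grading n 𝒜')
      (wreathStructure n ζ) (wreathStructure n ζ') (WreathMod.grading n ℳ) where
  tower_left := inferInstance
  tower_right := inferInstance
  smul_comm := inferInstance
  isInternal := wgrading_isInternal hM.isInternal
  smul_mem hs ht := wmul_mem (β := lactBilin O A M) (fun ha hb => hM.smul_mem ha hb) hs ht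
  op_smul_mem hs ht := wmul_mem (β := ractBilin O A' M) (fun ha hb => hM.op_smul_mem ha hb) hs ht
  twist {x m} c hm := by
    induction hm using Submodule.span_induction with
    | zero => simp
    | smul r s _ h => rw [smul_comm, h, smul_comm]
    | add s s' _ _ h h' => rw [smul_add, h, h', smul_add]
    | mem t ht =>
      obtain ⟨m, hm, rfl⟩ := ht
      induction c using TPow.induction with
      | zero => simp
      | smul r s h => rw [map_smul, op_smul, smul_assoc, h, map_smul, map_smul, smul_assoc]
      | add s s' h h' => rw [map_add, op_add, add_smul, h, h', map_add, map_add, add_smul]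
      | tprod c =>
        rw [wreathAct_tprod, wreathStructure_tprod, wreathStructure_tprod,
          WreathMod.op_pure_smul_pure, WreathMod.pure_smul_pure, mul_one, one_mul]
        congr 1
        funext i
        exact hM.twist _ (hm i)

theorem WreathMod.pure_sum {ι : Type*} [Fintype ι] (f : Fin n → ι → M) (σ : Equiv.Perm (Fin n)) :
    pure O (fun i => ∑ j, f i j) σ = ∑ J : Fin n → ι, pure O (fun i => f i (J i)) σ :=
  wpure_sum f σ

theorem WreathAlg.pure_sum {ι : Type*} [Fintype ι] (f : Fin n → ι → A) (σ : Equiv.Perm (Fin n)) :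
    pure O (fun i => ∑ j, f i j) σ = ∑ J : Fin n → ι, pure O (fun i => f i (J i)) σ :=
  wpure_sum f σ

theorem wreathMod_finite_left (n : ℕ) [Module.Finite A M] :
    Module.Finite (WreathAlg O n A) (WreathMod O n M) := by
  obtain ⟨k, s, hs⟩ := Module.Finite.exists_fin (R := A) (M := M)
  refine Module.finite_def.mpr (Submodule.fg_def.mpr
    ⟨Set.range fun J : Fin n → Fin k => WreathMod.pure O (fun i => s (J i)) 1,
      Set.finite_range _, eq_top_iff.mpr fun t ht => ?_⟩)
  clear ht
  induction t using WreathMod.induction with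
  | zero => exact zero_mem _
  | smul r t h =>
    rw [← one_smul (WreathAlg O n A) t, ← smul_assoc]
    exact Submodule.smul_mem _ _ h
  | add t t' h h' => exact add_mem h h'
  | pure m σ =>
    have hm : ∀ i, ∃ c : Fin k → A, ∑ j, c j • s j = m i := fun i =>
      (Submodule.mem_span_range_iff_exists_fun (R := A)).mp (hs ▸ Submodule.mem_top)
    choose c hc using hm
    rw [← funext hc, WreathMod.pure_sum]
    refine Submodule.sum_mem _ fun J _ => ?_
    -- The coefficient carries `σ` and therefore permutes the factors of the generator on its right.
    -- Using the index `J ∘ σ` undoes this.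
    have : WreathMod.pure O (fun i => c i (J i) • s (J i)) σ =
        WreathAlg.pure O (fun i => c i (J i)) σ •
          WreathMod.pure O (fun i => s (J (σ i))) 1 := by
      rw [WreathMod.pure_smul_pure]
      simp
    rw [this]
    exact Submodule.smul_mem _ _ (Submodule.subset_span ⟨fun i => J (σ i), rfl⟩)

theorem wreathMod_finite_right (n : ℕ) [Module.Finite A'ᵐᵒᵖ M] :
    Module.Finite (WreathAlg O n A')ᵐᵒᵖ (WreathMod O n M) := by
  obtain ⟨k, s, hs⟩ := Module.Finite.exists_fin (R := A'ᵐᵒᵖ) (M := M)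
  refine Module.finite_def.mpr (Submodule.fg_def.mpr
    ⟨Set.range fun J : Fin n → Fin k => WreathMod.pure O (fun i => s (J i)) 1,
      Set.finite_range _, eq_top_iff.mpr fun t ht => ?_⟩)
  clear ht
  induction t using WreathMod.induction with
  | zero => exact zero_mem _
  | smul r t h =>
    rw [← one_smul (WreathAlg O n A')ᵐᵒᵖ t, ← smul_assoc]
    exact Submodule.smul_mem _ _ h
  | add t t' h h' => exact add_mem h h'
  | pure m σ =>
    have hm : ∀ i, ∃ c : Fin k → A'ᵐᵒᵖ, ∑ j, c j • s j = m i := fun i =>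
      (Submodule.mem_span_range_iff_exists_fun A'ᵐᵒᵖ).mp (hs ▸ Submodule.mem_top)
    choose c hc using hm
    rw [← funext hc, WreathMod.pure_sum]
    refine Submodule.sum_mem _ fun J _ => ?_
    -- Here the generator stands on the left with trivial permutation, so no reindexing occurs.
    have : WreathMod.pure O (fun i => c i (J i) • s (J i)) σ =
        op (WreathAlg.pure O (fun i => (c i (J i)).unop) σ) •
          WreathMod.pure O (fun i => s (J i)) 1 := by
      rw [WreathMod.op_pure_smul_pure]
      simp
    rw [this]
    exact Submodule.smul_mem _ _ (Submodule.subset_span ⟨J, rfl⟩)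

end WreathBimodule

/-! ## Modules induced from the identity component -/

section Balanced

variable {O : Type*} [CommRing O] {R : Type*} [Ring R]
variable {X : Type*} [AddCommGroup X] [Module O X] [Module Rᵐᵒᵖ X]
variable {Y : Type*} [AddCommGroup Y] [Module O Y] [Module R Y]
variable {P : Type*} [AddCommGroup P] [Module O P]

namespace BalancedTensor

variable (O R X Y) in
/-- The map `(x, y) ↦ x ⊗ y` as a bilinear map. -/
def mk : X →ₗ[O] Y →ₗ[O] BalancedTensor O R X Y :=
  (TensorProduct.mk O X Y).compr₂ (balancedRel O R X Y).mkQ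

theorem mk_apply (x : X) (y : Y) : mk O R X Y x y = tmul O R x y := rfl

theorem op_smul_tmul_eq (r : R) (x : X) (y : Y) : tmul O R (op r • x) y = tmul O R x (r • y) :=
  (Submodule.Quotient.eq _).mpr (Submodule.subset_span ⟨x, r, y, rfl⟩)

theorem induction {p : BalancedTensor O R X Y → Prop} (t : BalancedTensor O R X Y) (zero : p 0)
    (tmul : ∀ x y, p (tmul O R x y)) (add : ∀ s t, p s → p t → p (s + t)) : p t := by
  obtain ⟨t, rfl⟩ := (balancedRel O R X Y).mkQ_surjective t
  induction t using TensorProduct.induction_on with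
  | zero => rw [map_zero]; exact zero
  | tmul x y => exact tmul x y
  | add s t hs ht => rw [map_add]; exact add _ _ hs ht

/-- The linear map on `X ⊗_R Y` defined by a balanced bilinear map. -/
def lift (f : X →ₗ[O] Y →ₗ[O] P) (hf : ∀ x (r : R) y, f (op r • x) y = f x (r • y)) :
    BalancedTensor O R X Y →ₗ[O] P :=
  (balancedRel O R X Y).liftQ (TensorProduct.lift f) (by
    refine Submodule.span_le.mpr ?_
    rintro _ ⟨x, r, y, rfl⟩
    simp [hf])

theorem lift_tmul (f : X →ₗ[O] Y →ₗ[O] P) (hf : ∀ x (r : R) y, f (op r • x) y = f x (r • y))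
    (x : X) (y : Y) : lift f hf (tmul O R x y) = f x y := rfl

end BalancedTensor

end Balanced

/-! ### Transport of graded bimodules along isomorphisms -/

section Transport

variable {O : Type*} [CommRing O] {Γ : Type*} [Group Γ]
variable {C : Type*} [Ring C] [Algebra O C]
variable {A : Type*} [Ring A] [Algebra O A] {A' : Type*} [Ring A'] [Algebra O A']
variable {M : Type*} [AddCommGroup M] [Module O M] [Module A M] [Module A'ᵐᵒᵖ M]
variable {N : Type*} [AddCommGroup N] [Module O N] [Module A N] [Module A'ᵐᵒᵖ N]

theorem isInternal_of_equiv {ι : Type*} [Finite ι] {_ : DecidableEq ι}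
    {ℳ : ι → Submodule O M} {𝒩 : ι → Submodule O N}
    (h : DirectSum.IsInternal 𝒩) (e : M ≃ₗ[O] N)
    (he : ∀ g, (ℳ g).map (e : M →ₗ[O] N) = 𝒩 g) : DirectSum.IsInternal ℳ := by
  have := Fintype.ofFinite ι
  obtain ⟨p, hp⟩ := exists_isProjFamily h
  have hmem : ∀ g m, m ∈ ℳ g ↔ e m ∈ 𝒩 g := fun g m => by simp [← he]
  refine IsProjFamily.isInternal
    (p := fun g => e.symm.toLinearMap ∘ₗ p g ∘ₗ e.toLinearMap) ⟨fun g m => ?_, fun m => ?_,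
    fun {g h m} hm hne => ?_⟩
  · simpa [hmem] using hp.mem g (e m)
  · simp [← map_sum, hp.sum]
  · simp [hp.of_ne ((hmem h m).mp hm) hne]

/-- Graded bimodules can be transported along isomorphisms. -/
theorem IsGradedBimoduleOver.of_equiv [Finite Γ] {ρ : Γ →* (C ≃ₐ[O] C)} {𝒜 : Γ → Submodule O A}
    {𝒜' : Γ → Submodule O A'} {ζ : C →ₐ[O] A} {ζ' : C →ₐ[O] A'} {ℳ : Γ → Submodule O M}
    {𝒩 : Γ → Submodule O N} (hN : IsGradedBimoduleOver ρ 𝒜 𝒜' ζ ζ' 𝒩) (e : M ≃ₗ[O] N)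
    (hl : ∀ (a : A) (m : M), e (a • m) = a • e m)
    (hr : ∀ (a' : A') (m : M), e (op a' • m) = op a' • e m)
    (he : ∀ g : Γ, (ℳ g).map (e : M →ₗ[O] N) = 𝒩 g) :
    IsGradedBimoduleOver ρ 𝒜 𝒜' ζ ζ' ℳ := by
  have hmem : ∀ g m, m ∈ ℳ g ↔ e m ∈ 𝒩 g := fun g m => by simp [← he]
  have hr' : ∀ (a' : A'ᵐᵒᵖ) (m : M), e (a' • m) = a' • e m := fun a' => hr a'.unop
  exact
    { tower_left := ⟨fun r a m => e.injective <| by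
        rw [hl, map_smul, hl, hN.tower_left.smul_assoc]⟩
      tower_right := ⟨fun r a m => e.injective <| by
        rw [hr', map_smul, hr', hN.tower_right.smul_assoc]⟩
      smul_comm := ⟨fun a a' m => e.injective <| by
        rw [hl, hr', hr', hl, hN.smul_comm.smul_comm]⟩
      isInternal := isInternal_of_equiv hN.isInternal e he
      smul_mem := fun ha hm => by
        rw [hmem] at hm ⊢
        rw [hl]
        exact hN.smul_mem ha hm
      op_smul_mem := fun hm ha => by
        rw [hmem] at hm ⊢
        rw [hr]
        exact hN.op_smul_mem hm ha
      twist := fun c hm => e.injective <| by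
        rw [hmem] at hm
        rw [hl, hr]
        exact hN.twist c hm }

theorem IsGradedAlgebra.induction [Finite Γ] {𝒜 : Γ → Submodule O A} (hA : IsGradedAlgebra 𝒜)
    {p : A → Prop} (a : A) (zero : p 0) (mem : ∀ g, ∀ a ∈ 𝒜 g, p a)
    (add : ∀ a b, p a → p b → p (a + b)) : p a := by
  classical
  have ha : a ∈ ⨆ g, 𝒜 g := hA.isInternal.submodule_iSup_eq_top ▸ trivial
  induction ha using Submodule.iSup_induction' with
  | mem g a h => exact mem g a h
  | zero => exact zero
  | add a b _ _ h h' => exact add a b h h'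

end Transport

/-! ### Graded modules over a crossed product are induced from degree one -/

section InducedEquiv

variable {O : Type*} [CommRing O] {G : Type*} [Group G] [Finite G]
variable {R : Type*} [Ring R] [Algebra O R] {R' : Type*} [Ring R'] [Algebra O R']
variable {B : Type*} [Ring B]
variable {N : Type*} [AddCommGroup N] [Module O N] [Module R N] [Module R'ᵐᵒᵖ N]
  [IsScalarTower O R N] [IsScalarTower O R'ᵐᵒᵖ N] [SMulCommClass R R'ᵐᵒᵖ N]
variable {N₁ : Type*} [AddCommGroup N₁] [Module O N₁]
variable {𝓡 : G → Submodule O R} {𝓡' : G → Submodule O R'} {𝓝 : G → Submodule O N}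
variable {ι : N₁ →ₗ[O] N}

/-- `N₁` is identified with the component `𝓝 1` of `N` by `ι`. -/
structure IsOneComponent (𝓝 : G → Submodule O N) (ι : N₁ →ₗ[O] N) : Prop where
  exists_retraction : ∃ r : N →ₗ[O] N₁, r ∘ₗ ι = LinearMap.id
  mem : ∀ m, ι m ∈ 𝓝 1
  surj : ∀ m ∈ 𝓝 1, ∃ m₁, ι m₁ = m

-- Composing a retraction with the projection to degree one makes it vanish in all other degrees.
-- This vanishing isolates a single term in the inverse maps below.
open Classical in
theorem IsOneComponent.exists_proj (h : IsOneComponent 𝓝 ι) (hN : DirectSum.IsInternal 𝓝) :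
    ∃ r : N →ₗ[O] N₁, (∀ m, r (ι m) = m) ∧ (∀ m ∈ 𝓝 1, ι (r m) = m) ∧
      ∀ g, g ≠ 1 → ∀ m ∈ 𝓝 g, r m = 0 := by
  have := Fintype.ofFinite G
  obtain ⟨r, hr⟩ := h.exists_retraction
  obtain ⟨p, hp⟩ := exists_isProjFamily hN
  have h1 : ∀ m, (r ∘ₗ p 1) (ι m) = m := fun m => by
    rw [LinearMap.comp_apply, hp.of_mem (h.mem m)]
    exact LinearMap.congr_fun hr m
  refine ⟨r ∘ₗ p 1, h1, fun m hm => ?_, fun g hg m hm => ?_⟩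
  · obtain ⟨m₁, rfl⟩ := h.surj m hm
    rw [h1]
  · rw [LinearMap.comp_apply, hp.of_ne hm hg, map_zero]

section Left

variable [Module B N₁] [Module Bᵐᵒᵖ R] [SMulCommClass R Bᵐᵒᵖ R] {j : B → R}

open Classical in
/-- A graded module over a crossed product is induced from its identity component. -/
theorem exists_leftInduced_equiv (hR : IsCrossedProduct 𝓡) (hN : DirectSum.IsInternal 𝓝)
    (hsmul : ∀ {g x : G} {a : R} {m : N}, a ∈ 𝓡 g → m ∈ 𝓝 x → a • m ∈ 𝓝 (g * x))
    (hι : IsOneComponent 𝓝 ι) (hj : ∀ a ∈ 𝓡 1, ∃ b, j b = a)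
    (hop : ∀ (b : B) (a : R), op b • a = a * j b) (hB : ∀ (b : B) m, ι (b • m) = j b • ι m) :
    ∃ e : BalancedTensor O B R N₁ ≃ₗ[O] N,
      (∀ a m, e (BalancedTensor.tmul O B a m) = a • ι m) ∧
      (∀ (a : R) t, e (a • t) = a • e t) ∧
      ∀ g, (Submodule.span O {t | ∃ a ∈ 𝓡 g, ∃ m : N₁, t = BalancedTensor.tmul O B a m}).map
        (e : BalancedTensor O B R N₁ →ₗ[O] N) = 𝓝 g := by
  have := Fintype.ofFinite G
  obtain ⟨r, hr, hιr, hr0⟩ := hι.exists_proj hN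
  choose u hu using hR.exists_unit
  have hu' : ∀ g, ((u g)⁻¹ : Rˣ).val ∈ 𝓡 g⁻¹ := fun g => hR.toIsGradedAlgebra.inv_mem (hu g)
  let Φ : BalancedTensor O B R N₁ →ₗ[O] N :=
    BalancedTensor.lift ((lactBilin O R N).compl₂ ι) fun a b m => by
      change (op b • a) • ι m = a • ι (b • m)
      rw [hop, hB, mul_smul]
  have hΦ : ∀ a m, Φ (BalancedTensor.tmul O B a m) = a • ι m := fun a m =>
    BalancedTensor.lift_tmul _ _ a m
  -- The candidate inverse sends `m` of degree `g` to `u g ⊗ (u g)⁻¹ m`. Summing over all degrees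
  -- makes it linear on `N`, and `r` kills every term of the wrong degree.
  let Ψ : N →ₗ[O] BalancedTensor O B R N₁ :=
    ∑ g, BalancedTensor.mk O B R N₁ (u g) ∘ₗ r ∘ₗ Algebra.lsmul O O N ((u g)⁻¹ : Rˣ).val
  have hΨ : ∀ {g : G} {m : N}, m ∈ 𝓝 g → Ψ m = BalancedTensor.tmul O B (u g : R)
      (r (((u g)⁻¹ : Rˣ).val • m)) := by
    intro g m hm
    simp only [Ψ, LinearMap.sum_apply, LinearMap.comp_apply, BalancedTensor.mk_apply,
      Algebra.lsmul_coe]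
    refine Finset.sum_eq_single g (fun x _ hx => ?_) (by simp)
    rw [hr0 (x⁻¹ * g) (fun h => hx (inv_mul_eq_one.mp h)) _ (hsmul (hu' x) hm),
      BalancedTensor.tmul_zero]
  have hone : ∀ {g : G} {m : N}, m ∈ 𝓝 g → ((u g)⁻¹ : Rˣ).val • m ∈ 𝓝 1 := fun {g m} hm => by
    simpa using hsmul (hu' g) hm
  have hΦΨ : ∀ {g : G} {m : N}, m ∈ 𝓝 g → Φ (Ψ m) = m := fun {g m} hm => by
    rw [hΨ hm, hΦ, hιr _ (hone hm), smul_smul, Units.mul_inv, one_smul]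
  have h1 : Φ ∘ₗ Ψ = LinearMap.id := by
    ext m
    have hm : m ∈ ⨆ g, 𝓝 g := hN.submodule_iSup_eq_top ▸ trivial
    induction hm using Submodule.iSup_induction' with
    | mem g m hm => exact hΦΨ hm
    | zero => simp
    | add x y _ _ hx hy => rw [map_add, map_add, hx, hy]
  -- A homogeneous `a` equals `u g` times an element of degree one. The latter comes from `B` and
  -- crosses the balanced tensor sign.
  have hΨΦ : ∀ a m, Ψ (Φ (BalancedTensor.tmul O B a m)) = BalancedTensor.tmul O B a m := by
    intro a m
    induction a using hR.toIsGradedAlgebra.induction with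
    | zero => rw [BalancedTensor.zero_tmul, map_zero, map_zero]
    | add a b ha hb => rw [BalancedTensor.add_tmul, map_add, map_add, ha, hb]
    | mem g a ha =>
      obtain ⟨b, hb⟩ := hj (((u g)⁻¹ : Rˣ).val * a) (by
        simpa using hR.mul_mem (hu' g) ha)
      have hm : a • ι m ∈ 𝓝 g := by simpa using hsmul ha (hι.mem m)
      rw [hΦ, hΨ hm, smul_smul, ← hb, ← hB, hr, ← BalancedTensor.op_smul_tmul_eq, hop, hb,
        Units.mul_inv_cancel_left]
  have h2 : Ψ ∘ₗ Φ = LinearMap.id := BalancedTensor.hom_ext O B hΨΦ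
  refine ⟨LinearEquiv.ofLinearMap Φ Ψ h1 h2, hΦ, fun a t => ?_, fun g => ?_⟩
  · change Φ _ = a • Φ _
    induction t using BalancedTensor.induction with
    | zero => simp
    | add s t hs ht => rw [smul_add, map_add, map_add, hs, ht, smul_add]
    | tmul x m => rw [BalancedTensor.smul_tmul, hΦ, hΦ, smul_eq_mul, mul_smul]
  · refine le_antisymm ?_ fun m hm => ?_
    · rw [Submodule.map_span_le]
      rintro _ ⟨a, ha, m, rfl⟩
      change Φ _ ∈ _
      rw [hΦ]
      simpa using hsmul ha (hι.mem m)
    · exact ⟨Ψ m, (hΨ hm) ▸ Submodule.subset_span ⟨_, hu g, _, rfl⟩, hΦΨ hm⟩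

/-- The defining formula of the right module structure on an induced module. -/
def IsInducedRightStructure (𝓡 : G → Submodule O R) (𝓡' : G → Submodule O R') (ι : N₁ →ₗ[O] N)
    (_ : Module R'ᵐᵒᵖ (BalancedTensor O B R N₁)) : Prop :=
  ∀ (x : G) (u : Rˣ), (u : R) ∈ 𝓡 x → ∀ a' ∈ 𝓡' x, ∀ (α : R) (m m₁ : N₁),
    ι m₁ = ((u⁻¹ : Rˣ) : R) • op a' • ι m →
      op a' • (BalancedTensor.tmul O B α m) = BalancedTensor.tmul O B (α * u) m₁

/-- After applying `e`, both sides become `α m a'`, because `u u⁻¹` cancels. This gives existence by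
transport of structure. -/
theorem isInducedRightStructure_of_equiv (e : BalancedTensor O B R N₁ ≃ₗ[O] N)
    (he : ∀ a m, e (BalancedTensor.tmul O B a m) = a • ι m) :
    IsInducedRightStructure 𝓡 𝓡' ι
      (e.toAddEquiv.module _ : Module R'ᵐᵒᵖ (BalancedTensor O B R N₁)) := by
  intro x u _ a' _ α m m₁ h
  refine e.symm_apply_eq.mpr ?_
  change op a' • e _ = _
  rw [he, he, h, smul_smul, mul_assoc, Units.mul_inv, mul_one, ← smul_comm α]

/-- The formula determines the action: for homogeneous `a'` there is a unit `u` of the same degree,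
and `u⁻¹ m a'` has degree one, so it is some `ι m₁`. Hence `e` is right linear for every admissible
structure. -/
theorem IsInducedRightStructure.map_op_smul (hR : IsCrossedProduct 𝓡) (hR' : IsGradedAlgebra 𝓡')
    (hsmul : ∀ {g x : G} {a : R} {m : N}, a ∈ 𝓡 g → m ∈ 𝓝 x → a • m ∈ 𝓝 (g * x))
    (hop_smul : ∀ {x g : G} {m : N} {a' : R'}, m ∈ 𝓝 x → a' ∈ 𝓡' g → op a' • m ∈ 𝓝 (x * g))
    (hι : IsOneComponent 𝓝 ι) (e : BalancedTensor O B R N₁ ≃ₗ[O] N)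
    (he : ∀ a m, e (BalancedTensor.tmul O B a m) = a • ι m)
    {i : Module R'ᵐᵒᵖ (BalancedTensor O B R N₁)} (hi : IsInducedRightStructure 𝓡 𝓡' ι i)
    (a' : R') (t : BalancedTensor O B R N₁) : e (op a' • t) = op a' • e t := by
  induction a' using hR'.induction with
  | zero => rw [op_zero, zero_smul, zero_smul, map_zero]
  | add a b ha hb => rw [op_add, add_smul, add_smul, map_add, ha, hb]
  | mem g a' ha' =>
    induction t using BalancedTensor.induction with
    | zero => rw [smul_zero, map_zero, smul_zero]
    | add s t hs ht => rw [smul_add, map_add, map_add, smul_add, hs, ht]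
    | tmul α m =>
      obtain ⟨u, hu⟩ := hR.exists_unit g
      obtain ⟨m₁, hm₁⟩ := hι.surj (((u⁻¹ : Rˣ) : R) • op a' • ι m) (by
        simpa using hsmul (hR.toIsGradedAlgebra.inv_mem hu) (hop_smul (hι.mem m) ha'))
      rw [hi g u hu a' ha' α m m₁ hm₁, he, he, hm₁, smul_smul, mul_assoc, Units.mul_inv, mul_one,
        ← smul_comm α]

end Left

section Right

variable [Module Bᵐᵒᵖ N₁] [Module B R'] [SMulCommClass B R'ᵐᵒᵖ R'] {j : B → R'}

open Classical in
/-- A graded right module over a crossed product is induced from its identity component. -/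
theorem exists_rightInduced_equiv (hR : IsCrossedProduct 𝓡') (hN : DirectSum.IsInternal 𝓝)
    (hsmul : ∀ {x g : G} {m : N} {a : R'}, m ∈ 𝓝 x → a ∈ 𝓡' g → op a • m ∈ 𝓝 (x * g))
    (hι : IsOneComponent 𝓝 ι) (hj : ∀ a ∈ 𝓡' 1, ∃ b, j b = a)
    (hop : ∀ (b : B) (a : R'), b • a = j b * a)
    (hB : ∀ (b : B) m, ι (op b • m) = op (j b) • ι m) :
    ∃ e : BalancedTensor O B N₁ R' ≃ₗ[O] N,
      (∀ m a, e (BalancedTensor.tmul O B m a) = op a • ι m) ∧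
      (∀ (a : R') t, e (op a • t) = op a • e t) ∧
      ∀ g, (Submodule.span O {t | ∃ m : N₁, ∃ a ∈ 𝓡' g, t = BalancedTensor.tmul O B m a}).map
        (e : BalancedTensor O B N₁ R' →ₗ[O] N) = 𝓝 g := by
  have := Fintype.ofFinite G
  obtain ⟨r, hr, hιr, hr0⟩ := hι.exists_proj hN
  choose u hu using hR.exists_unit
  have hu' : ∀ g, ((u g)⁻¹ : R'ˣ).val ∈ 𝓡' g⁻¹ := fun g => hR.toIsGradedAlgebra.inv_mem (hu g)
  let Φ : BalancedTensor O B N₁ R' →ₗ[O] N :=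
    BalancedTensor.lift ((ractBilin O R' N).comp ι) fun m b a => by
      change op a • ι (op b • m) = op (b • a) • ι m
      rw [hop, hB, smul_smul, op_mul]
  have hΦ : ∀ m a, Φ (BalancedTensor.tmul O B m a) = op a • ι m := fun m a =>
    BalancedTensor.lift_tmul _ _ m a
  -- Mirror image of the left case: in degree `g` the inverse is `m ↦ m (u g)⁻¹ ⊗ u g`.
  let Ψ : N →ₗ[O] BalancedTensor O B N₁ R' :=
    ∑ g, (BalancedTensor.mk O B N₁ R').flip (u g) ∘ₗ r ∘ₗ
      Algebra.lsmul O O N (op ((u g)⁻¹ : R'ˣ).val)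
  have hΨ : ∀ {g : G} {m : N}, m ∈ 𝓝 g → Ψ m = BalancedTensor.tmul O B
      (r (op ((u g)⁻¹ : R'ˣ).val • m)) (u g : R') := by
    intro g m hm
    simp only [Ψ, LinearMap.sum_apply, LinearMap.comp_apply, BalancedTensor.mk_apply,
      LinearMap.flip_apply, Algebra.lsmul_coe]
    refine Finset.sum_eq_single g (fun x _ hx => ?_) (by simp)
    rw [hr0 (g * x⁻¹) (fun h => hx (mul_inv_eq_one.mp h).symm) _ (hsmul hm (hu' x)),
      BalancedTensor.zero_tmul]
  have hone : ∀ {g : G} {m : N}, m ∈ 𝓝 g → op ((u g)⁻¹ : R'ˣ).val • m ∈ 𝓝 1 :=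
    fun {g m} hm => by simpa using hsmul hm (hu' g)
  have hΦΨ : ∀ {g : G} {m : N}, m ∈ 𝓝 g → Φ (Ψ m) = m := fun {g m} hm => by
    rw [hΨ hm, hΦ, hιr _ (hone hm), smul_smul, ← op_mul, Units.inv_mul, op_one, one_smul]
  have h1 : Φ ∘ₗ Ψ = LinearMap.id := by
    ext m
    have hm : m ∈ ⨆ g, 𝓝 g := hN.submodule_iSup_eq_top ▸ trivial
    induction hm using Submodule.iSup_induction' with
    | mem g m hm => exact hΦΨ hm
    | zero => simp
    | add x y _ _ hx hy => rw [map_add, map_add, hx, hy]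
  have hΨΦ : ∀ m a, Ψ (Φ (BalancedTensor.tmul O B m a)) = BalancedTensor.tmul O B m a := by
    intro m a
    induction a using hR.toIsGradedAlgebra.induction with
    | zero => rw [BalancedTensor.tmul_zero, map_zero, map_zero]
    | add a b ha hb => rw [BalancedTensor.tmul_add, map_add, map_add, ha, hb]
    | mem g a ha =>
      obtain ⟨b, hb⟩ := hj (a * ((u g)⁻¹ : R'ˣ).val) (by
        simpa using hR.mul_mem ha (hu' g))
      have hm : op a • ι m ∈ 𝓝 g := by simpa using hsmul (hι.mem m) ha
      rw [hΦ, hΨ hm, smul_smul, ← op_mul, ← hb, ← hB, hr, BalancedTensor.op_smul_tmul_eq, hop, hb,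
        Units.inv_mul_cancel_right]
  have h2 : Ψ ∘ₗ Φ = LinearMap.id := BalancedTensor.hom_ext O B hΨΦ
  refine ⟨LinearEquiv.ofLinearMap Φ Ψ h1 h2, hΦ, fun a t => ?_, fun g => ?_⟩
  · change Φ _ = op a • Φ _
    induction t using BalancedTensor.induction with
    | zero => simp
    | add s t hs ht => rw [smul_add, map_add, map_add, hs, ht, smul_add]
    | tmul m x => rw [BalancedTensor.op_smul_tmul, hΦ, hΦ, op_smul_eq_mul, op_mul, mul_smul]
  · refine le_antisymm ?_ fun m hm => ?_
    · rw [Submodule.map_span_le]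
      rintro _ ⟨m, a, ha, rfl⟩
      change Φ _ ∈ _
      rw [hΦ]
      simpa using hsmul (hι.mem m) ha
    · exact ⟨Ψ m, (hΨ hm) ▸ Submodule.subset_span ⟨_, _, hu g, rfl⟩, hΦΨ hm⟩

/-- The defining formula of the left module structure on an induced module. -/
def IsInducedLeftStructure (𝓡 : G → Submodule O R) (𝓡' : G → Submodule O R') (ι : N₁ →ₗ[O] N)
    (_ : Module R (BalancedTensor O B N₁ R')) : Prop :=
  ∀ (x : G) (u' : R'ˣ), (u' : R') ∈ 𝓡' x → ∀ a ∈ 𝓡 x, ∀ (α' : R') (m m₁ : N₁),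
    ι m₁ = a • op ((u'⁻¹ : R'ˣ) : R') • ι m →
      a • (BalancedTensor.tmul O B m α') = BalancedTensor.tmul O B m₁ (u' * α')

theorem isInducedLeftStructure_of_equiv (e : BalancedTensor O B N₁ R' ≃ₗ[O] N)
    (he : ∀ m a, e (BalancedTensor.tmul O B m a) = op a • ι m) :
    IsInducedLeftStructure 𝓡 𝓡' ι
      (e.toAddEquiv.module _ : Module R (BalancedTensor O B N₁ R')) := by
  intro x u _ a _ α m m₁ h
  refine e.symm_apply_eq.mpr ?_
  change a • e _ = _
  rw [he, he, h, smul_comm a (op (u⁻¹ : R'ˣ).val), smul_smul, ← op_mul, Units.inv_mul_cancel_left,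
    smul_comm a]

/-- Here `a m u'⁻¹` has degree one when `u'` is a unit of the degree of `a`, so the formula computes
every `a (m ⊗ α')` and makes `e` left linear. -/
theorem IsInducedLeftStructure.map_smul (hR : IsGradedAlgebra 𝓡) (hR' : IsCrossedProduct 𝓡')
    (hsmul : ∀ {g x : G} {a : R} {m : N}, a ∈ 𝓡 g → m ∈ 𝓝 x → a • m ∈ 𝓝 (g * x))
    (hop_smul : ∀ {x g : G} {m : N} {a' : R'}, m ∈ 𝓝 x → a' ∈ 𝓡' g → op a' • m ∈ 𝓝 (x * g))
    (hι : IsOneComponent 𝓝 ι) (e : BalancedTensor O B N₁ R' ≃ₗ[O] N)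
    (he : ∀ m a, e (BalancedTensor.tmul O B m a) = op a • ι m)
    {i : Module R (BalancedTensor O B N₁ R')} (hi : IsInducedLeftStructure 𝓡 𝓡' ι i)
    (a : R) (t : BalancedTensor O B N₁ R') : e (a • t) = a • e t := by
  induction a using hR.induction with
  | zero => rw [zero_smul, zero_smul, map_zero]
  | add a b ha hb => rw [add_smul, add_smul, map_add, ha, hb]
  | mem g a ha =>
    induction t using BalancedTensor.induction with
    | zero => rw [smul_zero, map_zero, smul_zero]
    | add s t hs ht => rw [smul_add, map_add, map_add, smul_add, hs, ht]
    | tmul m α =>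
      obtain ⟨u, hu⟩ := hR'.exists_unit g
      obtain ⟨m₁, hm₁⟩ := hι.surj (a • op ((u⁻¹ : R'ˣ) : R') • ι m) (by
        simpa using hsmul ha (hop_smul (hι.mem m) (hR'.toIsGradedAlgebra.inv_mem hu)))
      rw [hi g u hu a ha α m m₁ hm₁, he, he, hm₁, smul_comm a (op (u⁻¹ : R'ˣ).val), smul_smul,
        ← op_mul, Units.inv_mul_cancel_left, smul_comm a]

end Right

end InducedEquiv

/-! ### Wreath products as induced modules -/

section WreathInduced

variable {O : Type*} [CommRing O] {n : ℕ} {Γ : Type*} [Group Γ] {C : Type*} [Ring C] [Algebra O C]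
variable {A : Type*} [Ring A] [Algebra O A] {A' : Type*} [Ring A'] [Algebra O A']
variable {M : Type*} [AddCommGroup M] [Module O M] [Module A M] [Module A'ᵐᵒᵖ M]
  [IsScalarTower O A M] [IsScalarTower O A'ᵐᵒᵖ M] [SMulCommClass A A'ᵐᵒᵖ M]
variable {ρ : Γ →* (C ≃ₐ[O] C)} {𝒞 : Γ → Submodule O C} {𝒜 : Γ → Submodule O A}
  {𝒜' : Γ → Submodule O A'} {ζ : C →ₐ[O] A} {ζ' : C →ₐ[O] A'} {ℳ : Γ → Submodule O M}

theorem oneEmb_tprod (hM : IsGradedBimoduleOver ρ 𝒜 𝒜' ζ ζ' ℳ) (m : Fin n → hM.One) :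
    oneEmb n hM (PiTensorProduct.tprod O m) = WreathMod.pure O (fun i => hM.incl (m i)) 1 := by
  change wincl M 1 (PiTensorProduct.map (fun _ => hM.incl) (PiTensorProduct.tprod O m)) = _
  rw [PiTensorProduct.map_tprod]
  rfl

/-- Since `M₁` is a direct summand of `M`, the tensor power of the projection onto it, applied to
the coefficient of the identity permutation, is a retraction. For a non-split submodule the map on
tensor powers could fail to be injective. -/
theorem isOneComponent_oneEmb [Finite Γ] (n : ℕ) (hM : IsGradedBimoduleOver ρ 𝒜 𝒜' ζ ζ' ℳ) :
    IsOneComponent (WreathMod.grading n ℳ) (oneEmb n hM) where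
  exists_retraction := by
    classical
    have := Fintype.ofFinite Γ
    obtain ⟨p, hp⟩ := exists_isProjFamily hM.isInternal
    let q : M →ₗ[O] hM.One := (p 1).codRestrict (ℳ 1) (hp.mem 1)
    have hq : ∀ m, q (hM.incl m) = m := fun m => Subtype.ext (hp.of_mem m.2)
    refine ⟨PiTensorProduct.map (fun _ => q) ∘ₗ wcoeff M 1,
      PiTensorProduct.ext (MultilinearMap.ext fun m => ?_)⟩
    change PiTensorProduct.map (fun _ => q) (wcoeff M 1 (oneEmb n hM (PiTensorProduct.tprod O m))) =
      PiTensorProduct.tprod O m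
    rw [oneEmb_tprod]
    erw [wcoeff_wpure]
    rw [if_pos rfl, PiTensorProduct.map_tprod]
    simp only [hq]
  mem m := by
    induction m using TPow.induction with
    | zero => simp
    | smul r m h => rw [map_smul]; exact Submodule.smul_mem _ _ h
    | add m m' h h' => rw [map_add]; exact add_mem h h'
    | tprod m =>
      rw [oneEmb_tprod]
      exact Submodule.subset_span ⟨_, fun i => (m i).2, rfl⟩
  surj m hm := by
    induction hm using Submodule.span_induction with
    | zero => exact ⟨0, map_zero _⟩
    | smul r m _ h =>
      obtain ⟨m₁, rfl⟩ := h
      exact ⟨r • m₁, map_smul _ _ _⟩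
    | add m m' _ _ h h' =>
      obtain ⟨m₁, rfl⟩ := h
      obtain ⟨m₂, rfl⟩ := h'
      exact ⟨m₁ + m₂, map_add _ _ _⟩
    | mem m hm =>
      obtain ⟨m, hm, rfl⟩ := hm
      exact ⟨PiTensorProduct.tprod O fun i => (⟨m i, hm i⟩ : ↥(ℳ 1)), oneEmb_tprod hM _⟩

theorem base_powHom_tprod (B : Subalgebra O A) (b : Fin n → B) :
    WreathAlg.base (powHom n B.val (PiTensorProduct.tprod O b)) =
      WreathAlg.pure O (fun i => (b i : A)) 1 := by
  rw [powHom_tprod, WreathAlg.base_tprod]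
  rfl

/-- Factors of degree one can cross the balanced tensor sign because they come from `B^{⊗n}`.
Surjectivity is all that this requires. -/
theorem exists_base_powHom_eq (hA : IsGradedAlgebra 𝒜) (a : WreathAlg O n A)
    (ha : a ∈ WreathAlg.grading n 𝒜 1) :
    ∃ b, WreathAlg.base (powHom n hA.oneAlg.val b) = a := by
  induction ha using Submodule.span_induction with
  | zero => exact ⟨0, by rw [map_zero, map_zero]⟩
  | smul r m _ h =>
    obtain ⟨m₁, rfl⟩ := h
    exact ⟨r • m₁, by rw [map_smul, map_smul]⟩
  | add m m' _ _ h h' =>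
    obtain ⟨m₁, rfl⟩ := h
    obtain ⟨m₂, rfl⟩ := h'
    exact ⟨m₁ + m₂, by rw [map_add, map_add]⟩
  | mem a ha =>
    obtain ⟨a, ha, rfl⟩ := ha
    exact ⟨PiTensorProduct.tprod O fun i => (⟨a i, ha i⟩ : hA.oneAlg), base_powHom_tprod _ _⟩

theorem TPow.smul_smul_base (b : TPow O n A) (r : O) (m : TPow O n M) : b • r • m = r • b • m :=
  map_smul (PiTensorProduct.map₂ (fun _ : Fin n =>
    (Algebra.lsmul O O M : A →ₐ[O] _).toLinearMap) b) r m

theorem TPow.base_smul_smul (r : O) (b : TPow O n A) (m : TPow O n M) :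
    (r • b) • m = r • b • m :=
  LinearMap.map_smul₂ (PiTensorProduct.map₂ (fun _ : Fin n =>
    (Algebra.lsmul O O M : A →ₐ[O] _).toLinearMap)) r b m

theorem TPow.op_smul_smul_base (b : TPow O n A') (r : O) (m : TPow O n M) :
    op b • r • m = r • op b • m :=
  map_smul (PiTensorProduct.map₂ (fun _ : Fin n => (Algebra.lsmul O O M : A'ᵐᵒᵖ →ₐ[O] _).toLinearMap
    ∘ₗ (MulOpposite.opLinearEquiv O).toLinearMap) b) r m

theorem TPow.op_base_smul_smul (r : O) (b : TPow O n A') (m : TPow O n M) :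
    op (r • b) • m = r • op b • m :=
  LinearMap.map_smul₂ (PiTensorProduct.map₂ (fun _ : Fin n =>
    (Algebra.lsmul O O M : A'ᵐᵒᵖ →ₐ[O] _).toLinearMap
      ∘ₗ (MulOpposite.opLinearEquiv O).toLinearMap)) r b m

theorem TPow.base_zero_smul (m : TPow O n M) : (0 : TPow O n A) • m = 0 :=
  LinearMap.map_zero₂ (PiTensorProduct.map₂ (fun _ : Fin n =>
    (Algebra.lsmul O O M : A →ₐ[O] _).toLinearMap)) m

theorem TPow.op_base_zero_smul (m : TPow O n M) : op (0 : TPow O n A') • m = 0 :=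
  LinearMap.map_zero₂ (PiTensorProduct.map₂ (fun _ : Fin n =>
    (Algebra.lsmul O O M : A'ᵐᵒᵖ →ₐ[O] _).toLinearMap
      ∘ₗ (MulOpposite.opLinearEquiv O).toLinearMap)) m

/-- This compatibility makes `a ⊗ m ↦ a m` balanced, hence well defined on the induced module. -/
theorem oneEmb_smul (hA : IsGradedAlgebra 𝒜) (hM : IsGradedBimoduleOver ρ 𝒜 𝒜' ζ ζ' ℳ)
    (b : TPow O n ↥hA.oneAlg) (m : TPow O n hM.One) :
    oneEmb n hM (b • m) = WreathAlg.base (powHom n hA.oneAlg.val b) • oneEmb n hM m := by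
  induction m using TPow.induction with
  | zero => simp
  | smul r m h =>
    rw [TPow.smul_smul_base, LinearMap.map_smul, LinearMap.map_smul, h, smul_comm r]
  | add m m' h h' => rw [smul_add, map_add, map_add, smul_add, h, h']
  | tprod m =>
    induction b using TPow.induction with
    | zero => rw [TPow.base_zero_smul, map_zero, map_zero, map_zero, zero_smul]
    | add b b' h h' => rw [add_smul, map_add, map_add, map_add, add_smul, h, h']
    | smul r b h =>
      rw [TPow.base_smul_smul, LinearMap.map_smul, h, map_smul, map_smul, smul_assoc]
    | tprod b =>
      rw [TPow.tprod_smul_tprod, oneEmb_tprod, oneEmb_tprod, base_powHom_tprod,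
        WreathMod.pure_smul_pure, mul_one]
      rfl

theorem oneEmb_op_smul (hA' : IsGradedAlgebra 𝒜') (hM : IsGradedBimoduleOver ρ 𝒜 𝒜' ζ ζ' ℳ)
    (b : TPow O n ↥hA'.oneAlg) (m : TPow O n hM.One) :
    oneEmb n hM (op b • m) = op (WreathAlg.base (powHom n hA'.oneAlg.val b)) • oneEmb n hM m := by
  induction m using TPow.induction with
  | zero => simp
  | smul r m h =>
    rw [TPow.op_smul_smul_base, LinearMap.map_smul, LinearMap.map_smul, h, smul_comm r]
  | add m m' h h' => rw [smul_add, map_add, map_add, smul_add, h, h']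
  | tprod m =>
    induction b using TPow.induction with
    | zero => rw [TPow.op_base_zero_smul, map_zero, map_zero, map_zero, op_zero, zero_smul]
    | add b b' h h' => rw [op_add, add_smul, map_add, map_add, map_add, op_add, add_smul, h, h']
    | smul r b h =>
      rw [TPow.op_base_smul_smul, LinearMap.map_smul, h, map_smul, map_smul, op_smul, smul_assoc]
    | tprod b =>
      rw [TPow.op_tprod_smul_tprod, oneEmb_tprod, oneEmb_tprod, base_powHom_tprod,
        WreathMod.op_pure_smul_pure, mul_one]
      rfl

theorem leftInduced_equiv [Finite Γ] (n : ℕ) (hA : IsCrossedProduct 𝒜)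
    (hM : IsGradedBimoduleOver ρ 𝒜 𝒜' ζ ζ' ℳ) :
    ∃ e : LeftInduced n hA.toIsGradedAlgebra hM ≃ₗ[O] WreathMod O n M,
      (∀ a m, e (BalancedTensor.tmul O _ a m) = a • oneEmb n hM m) ∧
      (∀ (a : WreathAlg O n A) t, e (a • t) = a • e t) ∧
      ∀ x, (leftInducedGrading n hA.toIsGradedAlgebra hM x).map
        (e : LeftInduced n hA.toIsGradedAlgebra hM →ₗ[O] WreathMod O n M) =
          WreathMod.grading n ℳ x :=
  exists_leftInduced_equiv (wreathAlg_isCrossedProduct n hA)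
    (wreathMod_isGradedBimoduleOver n hM).isInternal (wreathMod_isGradedBimoduleOver n hM).smul_mem
    (isOneComponent_oneEmb n hM) (exists_base_powHom_eq hA.toIsGradedAlgebra)
    (WreathAlg.sub_op_smul hA.toIsGradedAlgebra.oneAlg) (oneEmb_smul hA.toIsGradedAlgebra hM)

theorem rightInduced_equiv [Finite Γ] (n : ℕ) (hA' : IsCrossedProduct 𝒜')
    (hM : IsGradedBimoduleOver ρ 𝒜 𝒜' ζ ζ' ℳ) :
    ∃ e : RightInduced n hA'.toIsGradedAlgebra hM ≃ₗ[O] WreathMod O n M,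
      (∀ m a, e (BalancedTensor.tmul O _ m a) = op a • oneEmb n hM m) ∧
      (∀ (a : WreathAlg O n A') t, e (op a • t) = op a • e t) ∧
      ∀ x, (rightInducedGrading n hA'.toIsGradedAlgebra hM x).map
        (e : RightInduced n hA'.toIsGradedAlgebra hM →ₗ[O] WreathMod O n M) =
          WreathMod.grading n ℳ x :=
  exists_rightInduced_equiv (wreathAlg_isCrossedProduct n hA')
    (wreathMod_isGradedBimoduleOver n hM).isInternal
    (wreathMod_isGradedBimoduleOver n hM).op_smul_mem
    (isOneComponent_oneEmb n hM) (exists_base_powHom_eq hA'.toIsGradedAlgebra)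
    (WreathAlg.sub_smul hA'.toIsGradedAlgebra.oneAlg) (oneEmb_op_smul hA'.toIsGradedAlgebra hM)

end WreathInduced

/-! ### Existence and uniqueness of the second action -/

section WreathInducedStructure

variable {O : Type*} [CommRing O] {n : ℕ} {Γ : Type*} [Group Γ] {C : Type*} [Ring C] [Algebra O C]
variable {A : Type*} [Ring A] [Algebra O A] {A' : Type*} [Ring A'] [Algebra O A']
variable {M : Type*} [AddCommGroup M] [Module O M] [Module A M] [Module A'ᵐᵒᵖ M]
  [IsScalarTower O A M] [IsScalarTower O A'ᵐᵒᵖ M] [SMulCommClass A A'ᵐᵒᵖ M]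
variable {ρ : Γ →* (C ≃ₐ[O] C)} {𝒞 : Γ → Submodule O C} {𝒜 : Γ → Submodule O A}
  {𝒜' : Γ → Submodule O A'} {ζ : C →ₐ[O] A} {ζ' : C →ₐ[O] A'} {ℳ : Γ → Submodule O M}

theorem leftInduced_structure [Finite Γ] (n : ℕ) (hA : IsCrossedProduct 𝒜)
    (hA' : IsCrossedProduct 𝒜') (hM : IsGradedBimoduleOver ρ 𝒜 𝒜' ζ ζ' ℳ) :
    (∃! i : Module (WreathAlg O n A')ᵐᵒᵖ (LeftInduced n hA.toIsGradedAlgebra hM),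
        IsInducedRight n hA.toIsGradedAlgebra hM i) ∧
      (∀ i : Module (WreathAlg O n A')ᵐᵒᵖ (LeftInduced n hA.toIsGradedAlgebra hM),
        IsInducedRight n hA.toIsGradedAlgebra hM i →
        IsGradedBimoduleOver (wreathAct n ρ) (WreathAlg.grading n 𝒜) (WreathAlg.grading n 𝒜')
          (wreathStructure n ζ) (wreathStructure n ζ')
          (leftInducedGrading n hA.toIsGradedAlgebra hM) ∧
        GradedBimoduleIso (WreathAlg O n A) (WreathAlg O n A')
          (leftInducedGrading n hA.toIsGradedAlgebra hM) (WreathMod.grading n ℳ)) := by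
  obtain ⟨e, he, hel, heg⟩ := leftInduced_equiv n hA hM
  have hW := wreathMod_isGradedBimoduleOver n hM
  have hstr : ∀ i : Module (WreathAlg O n A')ᵐᵒᵖ (LeftInduced n hA.toIsGradedAlgebra hM),
      IsInducedRight n hA.toIsGradedAlgebra hM i →
        IsInducedRightStructure (WreathAlg.grading n 𝒜) (WreathAlg.grading n 𝒜') (oneEmb n hM) i :=
    fun i hi x u hu a' ha' => hi x u hu a' ha'
  have key : ∀ i : Module (WreathAlg O n A')ᵐᵒᵖ (LeftInduced n hA.toIsGradedAlgebra hM),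
      IsInducedRight n hA.toIsGradedAlgebra hM i → ∀ (a' : WreathAlg O n A') t,
        e (op a' • t) = op a' • e t := fun i hi =>
    IsInducedRightStructure.map_op_smul (𝓝 := WreathMod.grading n ℳ) (wreathAlg_isCrossedProduct n hA)
      (wreathAlg_isGradedAlgebra n hA'.toIsGradedAlgebra) hW.smul_mem hW.op_smul_mem
      (isOneComponent_oneEmb n hM) e he (hstr i hi)
  refine ⟨⟨e.toAddEquiv.module _, fun x u hu a' ha' =>
      isInducedRightStructure_of_equiv (𝓡 := WreathAlg.grading n 𝒜)
        (𝓡' := WreathAlg.grading n 𝒜') e he x u hu a' ha', fun i hi => ?_⟩,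
    fun i hi => ⟨hW.of_equiv e hel (key i hi) heg, e, hel, key i hi, heg⟩⟩
  -- Linearity of `e` forces the value of the action to be the preimage of `(e t) a'`, which is the
  -- transported action.
  refine Module.ext' _ _ fun a' t => ?_
  exact (e.symm_apply_eq.mpr (key i hi a'.unop t).symm).symm

theorem rightInduced_structure [Finite Γ] (n : ℕ) (hA : IsCrossedProduct 𝒜)
    (hA' : IsCrossedProduct 𝒜') (hM : IsGradedBimoduleOver ρ 𝒜 𝒜' ζ ζ' ℳ) :
    (∃! i : Module (WreathAlg O n A) (RightInduced n hA'.toIsGradedAlgebra hM),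
        IsInducedLeft n hA'.toIsGradedAlgebra hM i) ∧
      (∀ i : Module (WreathAlg O n A) (RightInduced n hA'.toIsGradedAlgebra hM),
        IsInducedLeft n hA'.toIsGradedAlgebra hM i →
        IsGradedBimoduleOver (wreathAct n ρ) (WreathAlg.grading n 𝒜) (WreathAlg.grading n 𝒜')
          (wreathStructure n ζ) (wreathStructure n ζ')
          (rightInducedGrading n hA'.toIsGradedAlgebra hM) ∧
        GradedBimoduleIso (WreathAlg O n A) (WreathAlg O n A')
          (rightInducedGrading n hA'.toIsGradedAlgebra hM) (WreathMod.grading n ℳ)) := by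
  obtain ⟨e, he, her, heg⟩ := rightInduced_equiv n hA' hM
  have hW := wreathMod_isGradedBimoduleOver n hM
  have hstr : ∀ i : Module (WreathAlg O n A) (RightInduced n hA'.toIsGradedAlgebra hM),
      IsInducedLeft n hA'.toIsGradedAlgebra hM i →
        IsInducedLeftStructure (WreathAlg.grading n 𝒜) (WreathAlg.grading n 𝒜') (oneEmb n hM) i :=
    fun i hi x u hu a ha => hi x u hu a ha
  have key : ∀ i : Module (WreathAlg O n A) (RightInduced n hA'.toIsGradedAlgebra hM),
      IsInducedLeft n hA'.toIsGradedAlgebra hM i → ∀ (a : WreathAlg O n A) t,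
        e (a • t) = a • e t := fun i hi =>
    IsInducedLeftStructure.map_smul (𝓝 := WreathMod.grading n ℳ) (wreathAlg_isGradedAlgebra n hA.toIsGradedAlgebra)
      (wreathAlg_isCrossedProduct n hA') hW.smul_mem hW.op_smul_mem
      (isOneComponent_oneEmb n hM) e he (hstr i hi)
  refine ⟨⟨e.toAddEquiv.module _, fun x u hu a ha =>
      isInducedLeftStructure_of_equiv (𝓡 := WreathAlg.grading n 𝒜)
        (𝓡' := WreathAlg.grading n 𝒜') e he x u hu a ha, fun i hi => ?_⟩,
    fun i hi => ⟨hW.of_equiv e (key i hi) her heg, e, key i hi, her, heg⟩⟩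
  refine Module.ext' _ _ fun a t => ?_
  exact (e.symm_apply_eq.mpr (key i hi a t).symm).symm

end WreathInducedStructure

/-! ## Graded Morita equivalences -/

section MoritaContext

variable {O : Type*} [CommRing O] {Γ : Type*} [Group Γ] {C : Type*} [Ring C] [Algebra O C]
variable {A : Type*} [Ring A] [Algebra O A] {A' : Type*} [Ring A'] [Algebra O A']
variable {M : Type*} [AddCommGroup M] [Module O M] [Module A M] [Module A'ᵐᵒᵖ M]
variable {N : Type*} [AddCommGroup N] [Module O N]

/-- The pairings `ε : M × N → A` and `β : N × M → A'` form a surjective Morita context (the bimodule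
structure of `N` is not needed). -/
structure IsSurjectiveContext (ε : M →ₗ[O] N →ₗ[O] A) (β : N →ₗ[O] M →ₗ[O] A') : Prop where
  smul_left : ∀ a m ν, ε (a • m) ν = a * ε m ν
  op_smul_right : ∀ ν m a', β ν (op a' • m) = β ν m * a'
  assoc : ∀ m ν m', ε m ν • m' = op (β ν m') • m
  exists_left : ∃ (κ : Type) (_ : Fintype κ) (x : κ → M) (ν : κ → N), ∑ i, ε (x i) (ν i) = 1
  exists_right : ∃ (κ : Type) (_ : Fintype κ) (ν : κ → N) (x : κ → M), ∑ i, β (ν i) (x i) = 1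

/-- Writing `1` as a sum of values of `β` gives `a = ∑ β (ν i) (x i a)`, so `a` is recovered from
its action on `M`. Later identities in `A'` are tested on `M` for this reason. -/
theorem op_smul_faithful {β : N →ₗ[O] M →ₗ[O] A'}
    (h : ∀ ν m a', β ν (op a' • m) = β ν m * a') {κ : Type} [Fintype κ] {ν : κ → N} {x : κ → M}
    (h1 : ∑ i, β (ν i) (x i) = 1) {a b : A'} (hab : ∀ m : M, op a • m = op b • m) : a = b := by
  rw [← one_mul a, ← one_mul b, ← h1, Finset.sum_mul, Finset.sum_mul]
  simp only [← h, hab]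

theorem BalancedTensor.exists_sum {R X Y : Type*} [Ring R] [AddCommGroup X] [Module O X]
    [Module Rᵐᵒᵖ X] [AddCommGroup Y] [Module O Y] [Module R Y] (t : BalancedTensor O R X Y) :
    ∃ (κ : Type) (_ : Fintype κ) (x : κ → X) (y : κ → Y), ∑ i, tmul O R (x i) (y i) = t := by
  induction t using BalancedTensor.induction with
  | zero => exact ⟨Empty, inferInstance, Empty.elim, Empty.elim, by simp⟩
  | tmul x y => exact ⟨Unit, inferInstance, fun _ => x, fun _ => y, by simp⟩
  | add s t hs ht =>
    obtain ⟨κ, _, x, y, rfl⟩ := hs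
    obtain ⟨κ', _, x', y', rfl⟩ := ht
    exact ⟨κ ⊕ κ', inferInstance, Sum.elim x x', Sum.elim y y', by simp⟩

section FromEquivalence

variable [IsScalarTower O A M] [IsScalarTower O A'ᵐᵒᵖ M] [SMulCommClass A A'ᵐᵒᵖ M]

/-- A Morita equivalence given by abstract isomorphisms `M ⊗ M* ≃ A`, `M* ⊗ M ≃ A'` yields a
surjective Morita context: the pairings are associative up to an automorphism of `M`. -/
theorem exists_isSurjectiveContext
    (f : BalancedTensor O A' M (LeftDual A A' M) ≃ₗ[O] A)
    (hfl : ∀ (a : A) t, f (a • t) = a • f t) (hfr : ∀ (a : A) t, f (op a • t) = op a • f t)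
    (g : BalancedTensor O A (LeftDual A A' M) M ≃ₗ[O] A')
    (hgl : ∀ (a : A') t, g (a • t) = a • g t) (hgr : ∀ (a : A') t, g (op a • t) = op a • g t) :
    ∃ (ε : M →ₗ[O] LeftDual A A' M →ₗ[O] A) (β : LeftDual A A' M →ₗ[O] M →ₗ[O] A'),
      IsSurjectiveContext ε β := by
  let ε : M →ₗ[O] LeftDual A A' M →ₗ[O] A := (BalancedTensor.mk O A' M _).compr₂ f.toLinearMap
  let γ : LeftDual A A' M →ₗ[O] M →ₗ[O] A' := (BalancedTensor.mk O A _ M).compr₂ g.toLinearMap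
  have hε : ∀ m φ, ε m φ = f (BalancedTensor.tmul O A' m φ) := fun _ _ => rfl
  have hγ : ∀ φ m, γ φ m = g (BalancedTensor.tmul O A φ m) := fun _ _ => rfl
  have hγl : ∀ (a' : A') φ m, γ (a' • φ) m = a' * γ φ m := fun a' φ m => by
    rw [hγ, ← BalancedTensor.smul_tmul, hgl]; rfl
  have hγr : ∀ φ m (a' : A'), γ φ (op a' • m) = γ φ m * a' := fun φ m a' => by
    rw [hγ, ← BalancedTensor.op_smul_tmul, hgr]; rfl
  have hγm : ∀ (a : A) φ m, γ (op a • φ) m = γ φ (a • m) := fun a φ m => by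
    rw [hγ, BalancedTensor.op_smul_tmul_eq, hγ]
  obtain ⟨κ, _, x, φ, hxφ⟩ := BalancedTensor.exists_sum (f.symm 1)
  obtain ⟨κ', _, ψ, y, hψy⟩ := BalancedTensor.exists_sum (g.symm 1)
  have h1 : ∑ i, ε (x i) (φ i) = 1 := by
    simp only [hε, ← map_sum, hxφ, LinearEquiv.apply_symm_apply]
  have h1' : ∑ i, γ (ψ i) (y i) = 1 := by
    simp only [hγ, ← map_sum, hψy, LinearEquiv.apply_symm_apply]
  -- `M ⊗ M* ⊗ M` can be contracted to `M` through either pairing. `L m'` is the contraction `m ⊗ φ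
  -- ↦ m γ(φ, m')`, to be compared with `ε(m, φ) m'`.
  let L : M → BalancedTensor O A' M (LeftDual A A' M) →ₗ[O] M := fun m' =>
    BalancedTensor.lift ((ractBilin O A' M).compl₂ (γ.flip m')) fun m a' φ => by
      change op (γ φ m') • op a' • m = op (γ (a' • φ) m') • m
      rw [hγl, op_mul, mul_smul]
  have hL : ∀ m' m φ, L m' (BalancedTensor.tmul O A' m φ) = op (γ φ m') • m := fun _ _ _ => rfl
  have hLl : ∀ m' (a : A) t, L m' (a • t) = a • L m' t := fun m' a t => by
    induction t using BalancedTensor.induction with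
    | zero => simp
    | add s t hs ht => rw [smul_add, map_add, map_add, smul_add, hs, ht]
    | tmul m φ => rw [BalancedTensor.smul_tmul, hL, hL, smul_comm a]
  have hLr : ∀ m' (a : A) t, L m' (op a • t) = L (a • m') t := fun m' a t => by
    induction t using BalancedTensor.induction with
    | zero => simp
    | add s t hs ht => rw [smul_add, map_add, map_add, hs, ht]
    | tmul m φ => rw [BalancedTensor.op_smul_tmul, hL, hL, hγm]
  -- `w` measures the discrepancy between the two contractions: `m γ(φ, m') = ε(m, φ) w(m')`, which
  -- is `hassoc`.
  let w : M →ₗ[O] M := ∑ i, ractBilin O A' M (x i) ∘ₗ γ (φ i)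
  have hw : ∀ m, w m = L m (f.symm 1) := fun m => by
    simp only [w, LinearMap.sum_apply, ← hxφ, map_sum, hL]
    rfl
  have hfa : ∀ a : A, f.symm a = a • f.symm 1 := fun a => f.injective <| by
    rw [hfl, f.apply_symm_apply, f.apply_symm_apply, smul_eq_mul, mul_one]
  have hfa' : ∀ a : A, f.symm a = op a • f.symm 1 := fun a => f.injective <| by
    rw [hfr, f.apply_symm_apply, f.apply_symm_apply, op_smul_eq_mul, one_mul]
  -- The element `f⁻¹(a)` equals both `a f⁻¹(1)` and `f⁻¹(1) a`. The first form lets `a` out of `L`,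
  -- and the second moves it into the argument.
  have hwl : ∀ (a : A) m, w (a • m) = a • w m := fun a m => by
    rw [hw, hw, ← hLr, ← hLl, ← hfa, ← hfa']
  have hassoc : ∀ m φ m', op (γ φ m') • m = ε m φ • w m' := fun m φ m' => by
    rw [← hwl, hw, ← hLr, ← hfa', hε, f.symm_apply_apply, hL]
  -- A right inverse of `w`, obtained from the decomposition of `1` in `A'`. Inserting it into `γ`
  -- cancels the discrepancy.
  let s : M →ₗ[O] M := ∑ j, (lactBilin O A M).flip (y j) ∘ₗ ε.flip (ψ j)
  have hs : ∀ m, s m = ∑ j, ε m (ψ j) • y j := fun m => by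
    simp only [s, LinearMap.sum_apply]
    rfl
  have hws : ∀ m, w (s m) = m := fun m => by
    rw [hs, map_sum]
    simp only [hwl, ← hassoc, ← Finset.sum_smul, ← Finset.op_sum, h1', op_one, one_smul]
  have hassoc' : ∀ m φ m', ε m φ • m' = op (γ φ (s m')) • m := fun m φ m' => by
    rw [hassoc, hws]
  have hfaith : ∀ {a b : A'}, (∀ m : M, op a • m = op b • m) → a = b := fun h =>
    op_smul_faithful hγr h1' h
  -- Right linearity of `s` is not established directly; that of the corrected pairing is tested on
  -- `M` by faithfulness. The decomposition of `1` uses `w (y j)` to compensate for `s`.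
  refine ⟨ε, γ.compl₂ s, fun a m ν => ?_, fun ν m a' => hfaith fun z => ?_, hassoc',
    ⟨κ, _, x, φ, h1⟩, ⟨κ', inferInstance, ψ, fun j => w (y j), hfaith fun z => ?_⟩⟩
  · rw [hε, ← BalancedTensor.smul_tmul, hfl]; rfl
  · change op (γ ν (s (op a' • m))) • z = op (γ ν (s m) * a') • z
    rw [← hassoc', op_mul, mul_smul, ← hassoc', smul_comm]
  · change op (∑ j, γ (ψ j) (s (w (y j)))) • z = _
    rw [Finset.op_sum, Finset.sum_smul]
    simp only [← hassoc', ← hassoc, ← Finset.sum_smul, ← Finset.op_sum, h1']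

end FromEquivalence

end MoritaContext

/-! ### Wreath products of Morita contexts -/

section WreathContext

variable {O : Type*} [CommRing O] {n : ℕ}
variable {A : Type*} [Ring A] [Algebra O A] {A' : Type*} [Ring A'] [Algebra O A']
variable {M : Type*} [AddCommGroup M] [Module O M] [Module A M] [Module A'ᵐᵒᵖ M]
  [IsScalarTower O A M] [IsScalarTower O A'ᵐᵒᵖ M] [SMulCommClass A A'ᵐᵒᵖ M]
variable {N : Type*} [AddCommGroup N] [Module O N]

variable (n) in
/-- The pairing of `M ≀ S_n` and `N ≀ S_n` with values in `A ≀ S_n`. -/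
def wreathLeftPairing (ε : M →ₗ[O] N →ₗ[O] A) :
    WreathMod O n M →ₗ[O] WreathMod O n N →ₗ[O] WreathAlg O n A := wmul ε

variable (n) in
/-- The pairing of `N ≀ S_n` and `M ≀ S_n` with values in `A' ≀ S_n`. -/
def wreathRightPairing (β : N →ₗ[O] M →ₗ[O] A') :
    WreathMod O n N →ₗ[O] WreathMod O n M →ₗ[O] WreathAlg O n A' := wmul β

/-- Each of the three identities is an instance of `wmul_assoc`, valid because it holds factorwise.
The decompositions of `1` come from expanding the `n`-th tensor power of one in the original
algebra, with all permutations trivial. -/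
theorem IsSurjectiveContext.wreath (n : ℕ) {ε : M →ₗ[O] N →ₗ[O] A} {β : N →ₗ[O] M →ₗ[O] A'}
    (h : IsSurjectiveContext ε β) :
    IsSurjectiveContext (wreathLeftPairing n ε) (wreathRightPairing n β) where
  smul_left := wmul_assoc (β₁ := lactBilin O A M) (β₂ := ε) (β₃ := ε) (β₄ := LinearMap.mul O A)
    h.smul_left
  op_smul_right ν m a' := (wmul_assoc (β₁ := β) (β₂ := LinearMap.mul O A')
    (β₃ := ractBilin O A' M) (β₄ := β) (fun ν m a' => (h.op_smul_right ν m a').symm) ν m a').symm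
  assoc := wmul_assoc (β₁ := ε) (β₂ := lactBilin O A M) (β₃ := β) (β₄ := ractBilin O A' M) h.assoc
  exists_left := by
    obtain ⟨κ, _, x, ν, h1⟩ := h.exists_left
    classical
    refine ⟨Fin n → κ, inferInstance, fun J => WreathMod.pure O (fun i => x (J i)) 1,
      fun J => WreathMod.pure O (fun i => ν (J i)) 1, ?_⟩
    have key : ∀ J : Fin n → κ, wreathLeftPairing n ε (WreathMod.pure O (fun i => x (J i)) 1)
        (WreathMod.pure O (fun i => ν (J i)) 1) =
          WreathAlg.pure O (fun i => ε (x (J i)) (ν (J i))) 1 := fun J =>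
      wmul_wpure ε _ _ 1 1
    simp only [key]
    rw [← WreathAlg.pure_sum fun _ j => ε (x j) (ν j), WreathAlg.one_def, h1]
  exists_right := by
    obtain ⟨κ, _, ν, x, h1⟩ := h.exists_right
    classical
    refine ⟨Fin n → κ, inferInstance, fun J => WreathMod.pure O (fun i => ν (J i)) 1,
      fun J => WreathMod.pure O (fun i => x (J i)) 1, ?_⟩
    have key : ∀ J : Fin n → κ, wreathRightPairing n β (WreathMod.pure O (fun i => ν (J i)) 1)
        (WreathMod.pure O (fun i => x (J i)) 1) =
          WreathAlg.pure O (fun i => β (ν (J i)) (x (J i))) 1 := fun J =>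
      wmul_wpure β _ _ 1 1
    simp only [key]
    rw [← WreathAlg.pure_sum fun _ j => β (ν j) (x j), WreathAlg.one_def, h1]

end WreathContext

/-! ### From Morita contexts to graded Morita equivalences -/

section GradedContext

variable {O : Type*} [CommRing O] {Γ : Type*} [Group Γ] [Finite Γ] {C : Type*} [Ring C] [Algebra O C]
variable {A : Type*} [Ring A] [Algebra O A] {A' : Type*} [Ring A'] [Algebra O A']
variable {M : Type*} [AddCommGroup M] [Module O M] [Module A M] [Module A'ᵐᵒᵖ M]
  [IsScalarTower O A M] [IsScalarTower O A'ᵐᵒᵖ M] [SMulCommClass A A'ᵐᵒᵖ M]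
variable {N : Type*} [AddCommGroup N] [Module O N]
variable {ρ : Γ →* (C ≃ₐ[O] C)} {𝒜 : Γ → Submodule O A} {𝒜' : Γ → Submodule O A'}
  {ζ : C →ₐ[O] A} {ζ' : C →ₐ[O] A'} {ℳ : Γ → Submodule O M}

/-- The evaluation map `M ⊗ M* → A`. -/
def dualEval : BalancedTensor O A' M (LeftDual A A' M) →ₗ[O] A :=
  BalancedTensor.lift (LinearMap.mk₂ O (fun (m : M) (φ : LeftDual A A' M) => φ m)
    (fun m m' φ => LinearMap.map_add φ m m') (fun r m φ => LinearMap.map_smul_of_tower φ r m)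
    (fun _ _ _ => rfl) (fun _ _ _ => rfl)) fun _ _ _ => rfl

theorem dualEval_tmul (m : M) (φ : LeftDual A A' M) :
    dualEval (O := O) (BalancedTensor.tmul O A' m φ) = φ m := rfl

theorem dualEval_smul (a : A) (t : BalancedTensor O A' M (LeftDual A A' M)) :
    dualEval (a • t) = a • dualEval t := by
  induction t using BalancedTensor.induction with
  | zero => simp
  | add s t hs ht => rw [smul_add, map_add, map_add, smul_add, hs, ht]
  | tmul m φ => exact LinearMap.map_smul φ a m

theorem dualEval_op_smul (a : A) (t : BalancedTensor O A' M (LeftDual A A' M)) :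
    dualEval (op a • t) = op a • dualEval t := by
  induction t using BalancedTensor.induction with
  | zero => simp
  | add s t hs ht => rw [smul_add, map_add, map_add, smul_add, hs, ht]
  | tmul m φ => rfl

theorem IsProjFamily.smul (hA : IsGradedBimoduleOver ρ 𝒜 𝒜' ζ ζ' ℳ) [Fintype Γ]
    {p : Γ → M →ₗ[O] M} (hp : IsProjFamily ℳ p) {g : Γ} {a : A} (ha : a ∈ 𝒜 g) (k : Γ) (m : M) :
    p (g * k) (a • m) = a • p k m := by
  conv_lhs => rw [← hp.sum m, Finset.smul_sum, map_sum]
  rw [Finset.sum_eq_single k]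
  · exact hp.of_mem (hA.smul_mem ha (hp.mem _ _))
  · exact fun h _ hh => hp.of_ne (hA.smul_mem ha (hp.mem _ _)) (by simpa using hh)
  · simp

theorem LeftDual.sum_apply {κ : Type*} [Fintype κ] (φ : κ → LeftDual A A' M) (m : M) :
    (∑ i, φ i) m = ∑ i, φ i m :=
  LinearMap.sum_apply _ (fun i => (φ i : M →ₗ[A] A)) m

theorem LeftDual.map_sum {κ : Type*} [Fintype κ] (φ : LeftDual A A' M) (z : κ → M) :
    φ (∑ i, z i) = ∑ i, φ (z i) :=
  _root_.map_sum (show M →ₗ[A] A from φ) z _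

/-- As `Γ` is finite, `φ` is the finite sum of its homogeneous parts `∑ x, q (x * g) ∘ φ ∘ p x`. The
point is that these parts are `A`-linear. -/
theorem iSup_dualGrading (hA : IsGradedAlgebra 𝒜) (hM : IsGradedBimoduleOver ρ 𝒜 𝒜' ζ ζ' ℳ) :
    ⨆ g, dualGrading A' 𝒜 ℳ g = ⊤ := by
  classical
  have := Fintype.ofFinite Γ
  obtain ⟨p, hp⟩ := exists_isProjFamily hM.isInternal
  obtain ⟨q, hq⟩ := exists_isProjFamily hA.isInternal
  refine eq_top_iff.mpr fun φ _ => ?_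
  let F : Γ → M →ₗ[O] A := fun g =>
    ∑ x, q (x * g) ∘ₗ (LinearMap.restrictScalars O (φ : M →ₗ[A] A)) ∘ₗ p x
  have hF : ∀ g m, F g m = ∑ x, q (x * g) (φ (p x m)) := fun g m => by
    simp only [F, LinearMap.sum_apply]
    rfl
  have hlin : ∀ g (a : A) m, F g (a • m) = a • F g m := by
    intro g a m
    induction a using hA.induction with
    | zero => simp
    | add a b ha hb => rw [add_smul, map_add, ha, hb, add_smul]
    | mem h a ha =>
      -- An element `a` of degree `h` shifts source and target degrees on the left by `h`, so the
      -- terms `h * x` and `x` correspond.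
      rw [hF, hF, Finset.smul_sum, ← Equiv.sum_comp (Equiv.mulLeft h)]
      refine Finset.sum_congr rfl fun x _ => ?_
      have e1 : φ (p (h * x) (a • m)) = a * φ (p x m) := by
        rw [hp.smul hM ha]
        exact LinearMap.map_smul φ a _
      rw [Equiv.coe_mulLeft, e1, smul_eq_mul]
      generalize φ (p x m) = b
      conv_lhs => rw [← hq.sum b, Finset.mul_sum, map_sum]
      rw [Finset.sum_eq_single (x * g)]
      · exact hq.of_mem (by rw [mul_assoc]; exact hA.mul_mem ha (hq.mem _ _))
      · exact fun k _ hk => hq.of_ne (hA.mul_mem ha (hq.mem _ _)) (by simpa [mul_assoc] using hk)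
      · simp
  let G : Γ → LeftDual A A' M := fun g =>
    ({ toFun := F g, map_add' := map_add (F g), map_smul' := hlin g } : M →ₗ[A] A)
  have hG : φ = ∑ g, G g := LinearMap.ext fun m => by
    refine Eq.trans ?_ (LeftDual.sum_apply G m).symm
    change φ m = ∑ g, F g m
    simp only [hF]
    rw [Finset.sum_comm]
    have : ∀ x, ∑ g, q (x * g) (φ (p x m)) = φ (p x m) := fun x => by
      exact (Equiv.sum_comp (Equiv.mulLeft x) fun g => q g (φ (p x m))).trans (hq.sum _)
    simp only [this]
    conv_lhs => rw [← hp.sum m]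
    exact LeftDual.map_sum φ _
  rw [hG]
  refine Submodule.sum_mem _ fun g _ => Submodule.mem_iSup_of_mem g fun x m hm => ?_
  change F g m ∈ _
  rw [hF, Finset.sum_eq_single x]
  · exact hq.mem _ _
  · intro y _ hy
    rw [hp.of_ne hm hy.symm]
    exact (congrArg _ (LinearMap.map_zero φ)).trans (map_zero _)
  · simp

theorem iSup_tensorGrading {R X Y : Type*} [Ring R] [AddCommGroup X] [Module O X] [Module Rᵐᵒᵖ X]
    [AddCommGroup Y] [Module O Y] [Module R Y] {𝒳 : Γ → Submodule O X} {𝒴 : Γ → Submodule O Y}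
    (h𝒳 : ⨆ g, 𝒳 g = ⊤) (h𝒴 : ⨆ g, 𝒴 g = ⊤) : ⨆ g, tensorGrading R 𝒳 𝒴 g = ⊤ := by
  refine eq_top_iff.mpr fun t ht => ?_
  clear ht
  induction t using BalancedTensor.induction with
  | zero => exact zero_mem _
  | add s t hs ht => exact add_mem hs ht
  | tmul x y =>
    have hx : x ∈ ⨆ g, 𝒳 g := h𝒳 ▸ trivial
    have hy : y ∈ ⨆ g, 𝒴 g := h𝒴 ▸ trivial
    induction hx using Submodule.iSup_induction' with
    | zero => rw [BalancedTensor.zero_tmul]; exact zero_mem _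
    | add x x' _ _ h h' => rw [BalancedTensor.add_tmul]; exact add_mem h h'
    | mem a x hx =>
      induction hy using Submodule.iSup_induction' with
      | zero => rw [BalancedTensor.tmul_zero]; exact zero_mem _
      | add x x' _ _ h h' => rw [BalancedTensor.tmul_add]; exact add_mem h h'
      | mem b y hy =>
        exact Submodule.mem_iSup_of_mem (a * b) (Submodule.subset_span ⟨a, b, x, y, rfl, hx, hy, rfl⟩)

theorem map_tensorGrading_le {R X Y P : Type*} [Ring R] [AddCommGroup X] [Module O X]
    [Module Rᵐᵒᵖ X] [AddCommGroup Y] [Module O Y] [Module R Y] [AddCommGroup P] [Module O P]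
    {𝒳 : Γ → Submodule O X} {𝒴 : Γ → Submodule O Y} {𝒬 : Γ → Submodule O P}
    (f : BalancedTensor O R X Y →ₗ[O] P)
    (h : ∀ a b x y, x ∈ 𝒳 a → y ∈ 𝒴 b → f (BalancedTensor.tmul O R x y) ∈ 𝒬 (a * b)) (g : Γ) :
    ∀ t ∈ tensorGrading R 𝒳 𝒴 g, f t ∈ 𝒬 g := by
  refine Submodule.map_le_iff_le_comap.mp ((Submodule.map_span_le _ _ _).mpr ?_)
  rintro _ ⟨a, b, x, y, rfl, hx, hy, rfl⟩
  exact h a b x y hx hy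

/-- The tensor components need only span: by `map_grading_eq`, directness of the target grading
makes the degree-compatible bijection map components onto components. -/
theorem tensor_iso_of_bijective {R S X Y : Type*} [Ring R] [AddCommGroup X] [Module O X]
    [Module Rᵐᵒᵖ X] [AddCommGroup Y] [Module O Y] [Module R Y] [Ring S] [Algebra O S]
    [Module S X] [Module Sᵐᵒᵖ Y] [IsScalarTower O S X] [SMulCommClass S Rᵐᵒᵖ X]
    [IsScalarTower O Sᵐᵒᵖ Y] [SMulCommClass R Sᵐᵒᵖ Y]
    {𝒳 : Γ → Submodule O X} {𝒴 : Γ → Submodule O Y} {𝒮 : Γ → Submodule O S}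
    (hS : IsGradedAlgebra 𝒮) (h𝒳 : ⨆ g, 𝒳 g = ⊤) (h𝒴 : ⨆ g, 𝒴 g = ⊤)
    (f : BalancedTensor O R X Y →ₗ[O] S) (hf : Function.Bijective f)
    (hl : ∀ (s : S) t, f (s • t) = s • f t) (hr : ∀ (s : S) t, f (op s • t) = op s • f t)
    (h : ∀ a b x y, x ∈ 𝒳 a → y ∈ 𝒴 b → f (BalancedTensor.tmul O R x y) ∈ 𝒮 (a * b)) :
    GradedBimoduleIso S S (tensorGrading R 𝒳 𝒴) 𝒮 := by
  classical
  exact ⟨LinearEquiv.ofBijective f hf, hl, hr, map_grading_eq hS.isInternal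
    (iSup_tensorGrading h𝒳 h𝒴) f hf.2 (map_tensorGrading_le f h)⟩

/-- A surjective Morita context of a graded bimodule induces a graded Morita equivalence. -/
theorem IsSurjectiveContext.inducesGradedMorita {ε : M →ₗ[O] N →ₗ[O] A}
    {β : N →ₗ[O] M →ₗ[O] A'} (h : IsSurjectiveContext ε β) (hA : IsGradedAlgebra 𝒜)
    (hA' : IsGradedAlgebra 𝒜') (hM : IsGradedBimoduleOver ρ 𝒜 𝒜' ζ ζ' ℳ) :
    InducesGradedMorita 𝒜 𝒜' ℳ := by
  classical
  have := Fintype.ofFinite Γ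
  obtain ⟨κ₁, _, x, μ, h1⟩ := h.exists_left
  obtain ⟨κ₂, _, ν, y, h1'⟩ := h.exists_right
  have hfaith : ∀ {a b : A'}, (∀ m : M, op a • m = op b • m) → a = b := fun hab =>
    op_smul_faithful h.op_smul_right h1' hab
  let Θ : N → LeftDual A A' M := fun ν =>
    ({ toFun := fun m => ε m ν
       map_add' := fun m m' => LinearMap.map_add₂ ε m m' ν
       map_smul' := fun a m => h.smul_left a m ν } : M →ₗ[A] A)
  have hΘ : ∀ ν m, Θ ν m = ε m ν := fun _ _ => rfl
  have hmap : ∀ (φ : LeftDual A A' M) (a : A) m, φ (a • m) = a * φ m := fun φ a m =>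
    LinearMap.map_smul φ a m
  -- The elements `y j` and the functionals `ε(·, ν j)` form a dual basis of `M` over `A`.
  have hbasis : ∀ m : M, ∑ j, ε m (ν j) • y j = m := fun m => by
    simp only [h.assoc, ← Finset.sum_smul, ← Finset.op_sum, h1', op_one, one_smul]
  -- The dual basis suggests `φ = ∑ ν j φ(y j)`, and `B` extends `β` from `N` to `M*` accordingly.
  -- By faithfulness `hB` determines `B`, so its linearity and balancedness follow from `hB` alone.
  let B : LeftDual A A' M →ₗ[O] M →ₗ[O] A' :=
    LinearMap.mk₂ O (fun φ m => ∑ j, β (ν j) (φ (y j) • m))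
      (fun φ ψ m => by
        rw [← Finset.sum_add_distrib]
        refine Finset.sum_congr rfl fun j _ => ?_
        rw [← map_add, ← add_smul]; rfl)
      (fun r φ m => by
        rw [Finset.smul_sum]
        refine Finset.sum_congr rfl fun j _ => ?_
        rw [← map_smul, ← smul_assoc]; rfl)
      (fun φ m m' => by simp only [smul_add, map_add, Finset.sum_add_distrib])
      (fun r φ m => by simp only [smul_comm _ r, map_smul, Finset.smul_sum])
  have hB : ∀ φ m m', op (B φ m') • m = φ m • m' := fun φ m m' => by
    change op (∑ j, β (ν j) (φ (y j) • m')) • m = _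
    rw [Finset.op_sum, Finset.sum_smul]
    simp only [← h.assoc, smul_smul, ← hmap, ← Finset.sum_smul]
    rw [← LeftDual.map_sum, hbasis]
  have hBop : ∀ φ m (a' : A'), B φ (op a' • m) = B φ m * a' := fun φ m a' => hfaith fun z => by
    rw [hB, op_mul, mul_smul, hB, smul_comm]
  have hBl : ∀ (a' : A') φ m, B (a' • φ) m = a' * B φ m := fun a' φ m => hfaith fun z => by
    rw [hB, op_mul, mul_smul, hB]; rfl
  have hBm : ∀ φ (a : A) m, B (op a • φ) m = B φ (a • m) := fun φ a m => hfaith fun z => by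
    rw [hB, hB, smul_smul]; rfl
  let E : BalancedTensor O A (LeftDual A A' M) M →ₗ[O] A' := BalancedTensor.lift B hBm
  have hE : ∀ φ m, E (BalancedTensor.tmul O A φ m) = B φ m := fun _ _ => rfl
  have htop : ⨆ g, ℳ g = ⊤ := hM.isInternal.submodule_iSup_eq_top
  have hdtop := iSup_dualGrading hA hM
  constructor
  · refine tensor_iso_of_bijective hA htop hdtop dualEval ?_ dualEval_smul dualEval_op_smul
      fun a b m φ hm hφ => hφ a m hm
    -- The inverse of evaluation multiplies `1 = ∑ ε (x i) (μ i)` by `a`. It inverts on the other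
    -- side because `φ = ∑ B(φ, x i) Θ(μ i)`.
    let S : A →ₗ[O] BalancedTensor O A' M (LeftDual A A' M) :=
      ∑ i, (BalancedTensor.mk O A' M (LeftDual A A' M)).flip (Θ (μ i)) ∘ₗ
        (lactBilin O A M).flip (x i)
    have hS : ∀ a, S a = ∑ i, BalancedTensor.tmul O A' (a • x i) (Θ (μ i)) := fun a => by
      simp only [S, LinearMap.sum_apply]
      rfl
    refine Function.bijective_iff_has_inverse.mpr ⟨S, fun t => ?_, fun a => ?_⟩
    · induction t using BalancedTensor.induction with
      | zero => rw [map_zero, map_zero]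
      | add s t hs ht => rw [map_add, map_add, hs, ht]
      | tmul m φ =>
        have hφ : ∑ i, B φ (x i) • Θ (μ i) = φ := LinearMap.ext fun z => by
          refine (LeftDual.sum_apply _ z).trans ?_
          have : ∀ i, (B φ (x i) • Θ (μ i)) z = φ z * ε (x i) (μ i) := fun i => by
            rw [LeftDual.smul_apply, hB, hmap, hΘ]
          simp only [this, ← Finset.mul_sum, h1, mul_one]
          rfl
        rw [dualEval_tmul, hS]
        simp only [← hB, BalancedTensor.op_smul_tmul_eq]
        simp only [← BalancedTensor.mk_apply, ← map_sum, hφ]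
    · rw [hS, map_sum]
      simp only [dualEval_tmul, hΘ, h.smul_left, ← Finset.mul_sum, h1, mul_one]
  · have hEl : ∀ (a' : A') t, E (a' • t) = a' • E t := fun a' t => by
      induction t using BalancedTensor.induction with
      | zero => simp
      | add s t hs ht => rw [smul_add, map_add, map_add, smul_add, hs, ht]
      | tmul φ m => rw [BalancedTensor.smul_tmul, hE, hE, hBl, smul_eq_mul]
    have hEr : ∀ (a' : A') t, E (op a' • t) = op a' • E t := fun a' t => by
      induction t using BalancedTensor.induction with
      | zero => simp
      | add s t hs ht => rw [smul_add, map_add, map_add, smul_add, hs, ht]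
      | tmul φ m => rw [BalancedTensor.op_smul_tmul, hE, hE, hBop, op_smul_eq_mul]
    refine tensor_iso_of_bijective hA' hdtop htop E ?_ hEl hEr fun a b φ m hφ hm => ?_
    -- This inverse uses the dual basis: `∑ Θ(ν j) ⊗ y j` is sent to `1`, and `φ = ∑ Θ(ν j) φ(y j)`
    -- gives the other composite.
    · let S : A' →ₗ[O] BalancedTensor O A (LeftDual A A' M) M :=
        ∑ j, BalancedTensor.mk O A (LeftDual A A' M) M (Θ (ν j)) ∘ₗ ractBilin O A' M (y j)
      have hS : ∀ a, S a = ∑ j, BalancedTensor.tmul O A (Θ (ν j)) (op a • y j) := fun a => by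
        simp only [S, LinearMap.sum_apply]
        rfl
      refine Function.bijective_iff_has_inverse.mpr ⟨S, fun t => ?_, fun a => ?_⟩
      · induction t using BalancedTensor.induction with
        | zero => rw [map_zero, map_zero]
        | add s t hs ht => rw [map_add, map_add, hs, ht]
        | tmul φ m =>
          have hφ : ∑ j, op (φ (y j)) • Θ (ν j) = φ := LinearMap.ext fun z => by
            refine (LeftDual.sum_apply _ z).trans ?_
            have : ∀ j, (op (φ (y j)) • Θ (ν j)) z = φ (ε z (ν j) • y j) := fun j => by
              rw [LeftDual.op_smul_apply, hmap, hΘ]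
            simp only [this, ← LeftDual.map_sum, hbasis]
            rfl
          rw [hE, hS]
          simp only [hB, ← BalancedTensor.op_smul_tmul_eq]
          simp only [← BalancedTensor.mk_apply, ← LinearMap.sum_apply, ← map_sum, hφ]
      · have h2 : ∑ j, B (Θ (ν j)) (y j) = 1 := hfaith fun z => by
          rw [Finset.op_sum, Finset.sum_smul]
          simp only [hB, hΘ, hbasis, op_one, one_smul]
        rw [hS, map_sum]
        simp only [hE, hBop, ← Finset.sum_mul, h2, one_mul]
    · rw [hE]
      obtain ⟨p, hp⟩ := exists_isProjFamily hM.isInternal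
      obtain ⟨q, hq⟩ := exists_isProjFamily hA'.isInternal
      -- The degree of `B(φ, m)` is read off its action. For `z` of degree `c`, `z B(φ, m) = φ(z) m`
      -- has degree `c a b`, so the `k`-part of `B(φ, m)` kills `z` unless `k = a b`.
      refine hq.mem_of_eq_zero fun k hk => hfaith fun z => ?_
      rw [op_zero, zero_smul]
      have hz : z ∈ ⨆ g, ℳ g := htop ▸ trivial
      induction hz using Submodule.iSup_induction' with
      | zero => rw [smul_zero]
      | add z z' _ _ hz hz' => rw [smul_add, hz, hz', add_zero]
      | mem c z hz =>
        have h3 : p (c * k) (op (B φ m) • z) = op (q k (B φ m)) • z := by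
          conv_lhs => rw [← hq.sum (B φ m), Finset.op_sum, Finset.sum_smul, map_sum]
          rw [Finset.sum_eq_single k]
          · exact hp.of_mem (hM.op_smul_mem hz (hq.mem _ _))
          · exact fun l _ hl => hp.of_ne (hM.op_smul_mem hz (hq.mem _ _)) (by simpa using hl)
          · simp
        rw [← h3, hB]
        exact hp.of_ne (hM.smul_mem (hφ c z hz) hm) fun e => hk (by
          rw [mul_assoc] at e; exact (mul_left_cancel e).symm)

end GradedContext

end GradedMorita

end

/-! ### The main theorem -/

open GradedMorita in
theorem mainTheorem1 {O : Type*} [CommRing O] {Γ : Type*} [Group Γ] [Finite Γ]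
    (n : ℕ) (hn : n ≠ 0)
    {C : Type*} [Ring C] [Algebra O C] {A : Type*} [Ring A] [Algebra O A]
    {A' : Type*} [Ring A'] [Algebra O A']
    {M : Type*} [AddCommGroup M] [Module O M] [Module A M] [Module A'ᵐᵒᵖ M]
    [IsScalarTower O A M] [IsScalarTower O A'ᵐᵒᵖ M] [SMulCommClass A A'ᵐᵒᵖ M]
    (𝒞 : Γ → Submodule O C) (ρ : Γ →* (C ≃ₐ[O] C)) (hC : IsGradedActedAlgebra 𝒞 ρ)
    (𝒜 : Γ → Submodule O A) (ζ : C →ₐ[O] A) (hA : IsCrossedProductOver 𝒞 ρ 𝒜 ζ)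
    (𝒜' : Γ → Submodule O A') (ζ' : C →ₐ[O] A') (hA' : IsCrossedProductOver 𝒞 ρ 𝒜' ζ')
    (ℳ : Γ → Submodule O M) (hM : IsGradedBimoduleOver ρ 𝒜 𝒜' ζ ζ' ℳ) :
    -- (1) the wreath product is a graded bimodule over the tensor power of `C`
    (IsGradedActedAlgebra (powGrading n 𝒞) (wreathAct n ρ) ∧
      IsCrossedProductOver (powGrading n 𝒞) (wreathAct n ρ)
        (WreathAlg.grading n 𝒜) (wreathStructure n ζ) ∧
      IsCrossedProductOver (powGrading n 𝒞) (wreathAct n ρ)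
        (WreathAlg.grading n 𝒜') (wreathStructure n ζ') ∧
      IsGradedBimoduleOver (wreathAct n ρ) (WreathAlg.grading n 𝒜) (WreathAlg.grading n 𝒜')
        (wreathStructure n ζ) (wreathStructure n ζ') (WreathMod.grading n ℳ) ∧
      (Module.Finite A M → Module.Finite (WreathAlg O n A) (WreathMod O n M)) ∧
      (Module.Finite A'ᵐᵒᵖ M → Module.Finite (WreathAlg O n A')ᵐᵒᵖ (WreathMod O n M))) ∧
    -- (2) it is induced, on either side, from the tensor power of the identity component
    ((∃! i : Module (WreathAlg O n A')ᵐᵒᵖ (LeftInduced n hA.toIsGradedAlgebra hM),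
        IsInducedRight n hA.toIsGradedAlgebra hM i) ∧
      (∀ i : Module (WreathAlg O n A')ᵐᵒᵖ (LeftInduced n hA.toIsGradedAlgebra hM),
        IsInducedRight n hA.toIsGradedAlgebra hM i →
        IsGradedBimoduleOver (wreathAct n ρ) (WreathAlg.grading n 𝒜) (WreathAlg.grading n 𝒜')
          (wreathStructure n ζ) (wreathStructure n ζ')
          (leftInducedGrading n hA.toIsGradedAlgebra hM) ∧
        GradedBimoduleIso (WreathAlg O n A) (WreathAlg O n A')
          (leftInducedGrading n hA.toIsGradedAlgebra hM) (WreathMod.grading n ℳ)) ∧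
      (∃! i : Module (WreathAlg O n A) (RightInduced n hA'.toIsGradedAlgebra hM),
        IsInducedLeft n hA'.toIsGradedAlgebra hM i) ∧
      (∀ i : Module (WreathAlg O n A) (RightInduced n hA'.toIsGradedAlgebra hM),
        IsInducedLeft n hA'.toIsGradedAlgebra hM i →
        IsGradedBimoduleOver (wreathAct n ρ) (WreathAlg.grading n 𝒜) (WreathAlg.grading n 𝒜')
          (wreathStructure n ζ) (wreathStructure n ζ')
          (rightInducedGrading n hA'.toIsGradedAlgebra hM) ∧
        GradedBimoduleIso (WreathAlg O n A) (WreathAlg O n A')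
          (rightInducedGrading n hA'.toIsGradedAlgebra hM) (WreathMod.grading n ℳ))) ∧
    -- (3) graded Morita equivalences pass to wreath products
    (InducesGradedMorita 𝒜 𝒜' ℳ →
      InducesGradedMorita (WreathAlg.grading n 𝒜) (WreathAlg.grading n 𝒜')
        (WreathMod.grading n ℳ)) := by
  have hW := wreathMod_isGradedBimoduleOver n hM
  refine ⟨⟨powGrading_isGradedActedAlgebra n hC, wreathAlg_isCrossedProductOver n hA,
    wreathAlg_isCrossedProductOver n hA', hW, fun _ => wreathMod_finite_left n,
    fun _ => wreathMod_finite_right n⟩, ?_, fun h => ?_⟩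
  · obtain ⟨h1, h2⟩ := leftInduced_structure n hA.toIsCrossedProduct hA'.toIsCrossedProduct hM
    obtain ⟨h3, h4⟩ := rightInduced_structure n hA.toIsCrossedProduct hA'.toIsCrossedProduct hM
    exact ⟨h1, h2, h3, h4⟩
  -- Only bimodule linearity enters the context. Degrees are recovered at the end from the gradings
  -- of the wreath products themselves.
  · obtain ⟨⟨f, hfl, hfr, _⟩, ⟨g, hgl, hgr, _⟩⟩ := h
    obtain ⟨ε, β, hεβ⟩ := exists_isSurjectiveContext f hfl hfr g hgl hgr
    exact (hεβ.wreath n).inducesGradedMorita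
      (wreathAlg_isGradedAlgebra n hA.toIsGradedAlgebra)
      (wreathAlg_isGradedAlgebra n hA'.toIsGradedAlgebra) hW
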